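/- For $n\ge 4$ let ${}_nw\in\mathfrak S_n$ be the permutation with one-line notation $$ {}_nw=[\,n,\,1,\,2,\,\dots,\,n-4,\,n-2,\,n-1,\,n-3\,] $$ (so ${}_4w=4231$, ${}_5w=51342$). Let $s_i$ denote the simple transposition $(i\ \,i+1)$, and let $\ell(w)$ be the number of inversions of $w\in\mathfrak S_n$. A reduced word of $w$ is a sequence $a_1a_2\cdots a_p$ of elements of $\{1,\dots,n-1\}$ with $w=s_{a_1}s_{a_2}\cdots s_{a_p}$ and $p=\ell(w)$. Let $\mathcal G_{w}$ be the simple graph whose vertices are the reduced words of $w$, two of them being adjacent if one is obtained from the other by a single commutation move (replacing two consecutive letters $ij$ by $ji$, where $|i-j|>1$) or a single braid move (replacing three consecutive letters $iji$ by $jij$, where $|i-j|=1$). **Theorem.** For every $n\ge 4$, the vertex-degree polynomial $P_{\mathcal G_{{}_nw}}(d)=\sum_{v}d^{\deg v}$, where $v$ runs over the vertices of $\mathcal G_{{}_nw}$, is $$P_{\mathcal G_{{}_nw}}(d)=2d+(n-2)d^2+(2n-6)d^3+\binom{n-3}{2}d^4 .$$ Moreover $$\sum_{v\in\mathcal G_{{}_nw}}\deg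 v=4\binom{n-1}{2},$$ and $\mathcal G_{{}_nw}$ contains exactly $\binom{n-2}{2}$ four-cycles, that is, exactly $\binom{n-2}{2}$ subgraphs isomorphic to the cycle $C_4$. -/

import Mathlib

namespace ReducedWordGraph

/-- The simple transposition exchanging the adjacent points `i` and `i + 1` of `Fin n`.
The letter `i : Fin (n - 1)` stands for the generator `s_{i+1}` of the symmetric group in
1-based numbering. -/
def simpleTransposition {n : ℕ} (i : Fin (n - 1)) : Equiv.Perm (Fin n) :=
  Equiv.swap ⟨i.val, by omega⟩ ⟨i.val + 1, by omega⟩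

/-- The length of a permutation: its number of inversions. -/
def length {n : ℕ} (w : Equiv.Perm (Fin n)) : ℕ :=
  (Finset.univ.filter fun p : Fin n × Fin n => p.1 < p.2 ∧ w p.2 < w p.1).card

/-- `a = a₁ a₂ ⋯ a_p` is a reduced word of `w` if `w = s_{a₁} s_{a₂} ⋯ s_{a_p}` and `p` is the
length of `w`. -/
def IsReducedWord {n : ℕ} (w : Equiv.Perm (Fin n)) (a : List (Fin (n - 1))) : Prop :=
  (a.map simpleTransposition).prod = w ∧ a.length = length w

/-- The set `R(w)` of reduced words of `w`, as a type. -/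
abbrev ReducedWord {n : ℕ} (w : Equiv.Perm (Fin n)) : Type :=
  {a : List (Fin (n - 1)) // IsReducedWord w a}

theorem finite_reducedWord {n : ℕ} (w : Equiv.Perm (Fin n)) : Finite (ReducedWord w) :=
  Set.Finite.to_subtype
    ((List.finite_length_eq (Fin (n - 1)) (length w)).subset fun _ h => h.2)

noncomputable instance {n : ℕ} (w : Equiv.Perm (Fin n)) : Fintype (ReducedWord w) :=
  have := finite_reducedWord w
  Fintype.ofFinite _

/-- `b` arises from `a` by one commutation `s_i s_j = s_j s_i`, `|i - j| > 1`, applied to two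
consecutive letters. -/
def CommutationMove {m : ℕ} (a b : List (Fin m)) : Prop :=
  ∃ (u v : List (Fin m)) (i j : Fin m), (i.val + 1 < j.val ∨ j.val + 1 < i.val) ∧
    a = u ++ [i, j] ++ v ∧ b = u ++ [j, i] ++ v

/-- `b` arises from `a` by one braid relation `s_i s_j s_i = s_j s_i s_j`, `|i - j| = 1`, applied
(in either direction) to three consecutive letters. -/
def BraidMove {m : ℕ} (a b : List (Fin m)) : Prop :=
  ∃ (u v : List (Fin m)) (i j : Fin m), (i.val + 1 = j.val ∨ j.val + 1 = i.val) ∧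
    a = u ++ [i, j, i] ++ v ∧ b = u ++ [j, i, j] ++ v

theorem CommutationMove.symm {m : ℕ} {a b : List (Fin m)} (h : CommutationMove a b) :
    CommutationMove b a := by
  obtain ⟨u, v, i, j, hij, ha, hb⟩ := h
  exact ⟨u, v, j, i, hij.symm, hb, ha⟩

theorem BraidMove.symm {m : ℕ} {a b : List (Fin m)} (h : BraidMove a b) : BraidMove b a := by
  obtain ⟨u, v, i, j, hij, ha, hb⟩ := h
  exact ⟨u, v, j, i, hij.symm, hb, ha⟩

theorem not_commutationMove_self {m : ℕ} (a : List (Fin m)) : ¬ CommutationMove a a := by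
  rintro ⟨u, v, i, j, hij, ha, hb⟩
  have h := ha.symm.trans hb
  simp at h
  obtain ⟨rfl, -⟩ := h
  omega

theorem not_braidMove_self {m : ℕ} (a : List (Fin m)) : ¬ BraidMove a a := by
  rintro ⟨u, v, i, j, hij, ha, hb⟩
  have h := ha.symm.trans hb
  simp at h
  obtain ⟨rfl, -⟩ := h
  omega

/-- The graph `𝒢_w` of reduced words of `w`: two reduced words are adjacent if they differ by one
commutation move or one braid move. -/
def reducedWordGraph {n : ℕ} (w : Equiv.Perm (Fin n)) : SimpleGraph (ReducedWord w) where
  Adj a b := CommutationMove a.val b.val ∨ BraidMove a.val b.val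
  symm := ⟨fun _ _ h => h.imp CommutationMove.symm BraidMove.symm⟩
  loopless := ⟨fun a h => h.elim (not_commutationMove_self a.val) (not_braidMove_self a.val)⟩

noncomputable instance {n : ℕ} (w : Equiv.Perm (Fin n)) :
    DecidableRel (reducedWordGraph w).Adj :=
  Classical.decRel _

/-- The vertex-degree polynomial `∑_v d ^ deg(v)` of a finite graph, in the variable
`d = Polynomial.X`. -/
noncomputable def vertexDegreePolynomial {V : Type*} [Fintype V] (G : SimpleGraph V)
    [DecidableRel G.Adj] : Polynomial ℤ :=
  ∑ v : V, Polynomial.X ^ G.degree v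

/-- The permutation `ₙw` with one-line notation `[n, 1, 2, …, n-4, n-2, n-1, n-3]`, `n ≥ 4`,
written on the points `0, …, n-1`: thus `0 ↦ n-1`, `i ↦ i-1` for `1 ≤ i ≤ n-4`, the points `n-3`
and `n-2` are fixed, and `n-1 ↦ n-4`. -/
def nw (n : ℕ) (hn : 4 ≤ n) : Equiv.Perm (Fin n) where
  toFun i :=
    if i.val = 0 then ⟨n - 1, by omega⟩
    else if i.val ≤ n - 4 then ⟨i.val - 1, by omega⟩
    else if i.val = n - 1 then ⟨n - 4, by omega⟩
    else i
  invFun i :=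
    if i.val = n - 1 then ⟨0, by omega⟩
    else if h : i.val < n - 4 then ⟨i.val + 1, by omega⟩
    else if i.val = n - 4 then ⟨n - 1, by omega⟩
    else i
  left_inv i := by
    obtain ⟨i, hi⟩ := i
    apply Fin.ext
    dsimp only
    grind
  right_inv i := by
    obtain ⟨i, hi⟩ := i
    apply Fin.ext
    dsimp only
    grind

end ReducedWordGraph

open ReducedWordGraph

namespace ReducedWordGraph

/-! Put n = m + 4, with letters 0, …, m + 2. Then the permutation is s_{m+2} ⋯ s_1 s_0 · s_{m+1} ·
s_{m+2}, and one reduced word, read from right to left, is m+2, m+1, 0, 1, …, m+2. Its first two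
letters can drift into the run 0, 1, …: the parameter j records how far m+2 has gone, k how far m+1
has gone, and j ≤ k because m+2 stays ahead of m+1. Drifting past a small letter is a commutation.
The exceptional steps are the braids k = m → m+1 and j = m+1 → m+2, and the step k = m+1 → m+2,
which commutes the final letters m and m+2.

These words, `wordLetter m k j` with j ≤ k ≤ m + 2, are all the reduced words: peeling off descents
from the right leaves at most two choices until only the last four points matter
(`sorts_compSwap_compSwap_cycleFun_iff`). Moves are exactly the unit steps in j or k: unit steps are
exhibited explicitly, and other pairs of words differ at positions too far apart, or of the wrong
shape, for one move (`stairWord_move_iff`).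

Hence the graph is a triangular staircase of grid cells with n - 1 rows (`stairIso`). Degrees are
read off from the boundary of the staircase, the degree sum is the derivative of the polynomial at
1, and the four-cycles are the unit squares (`copyCount_stairGraph_cycleGraph_four`). -/

/-! ### Length, descents and the last letter of a reduced word. -/

theorem val_simpleTransposition {n : ℕ} (i : Fin (n - 1)) (x : Fin n) :
    (simpleTransposition i x).val =
      if x.val = i.val then i.val + 1 else if x.val = i.val + 1 then i.val else x.val := by
  simp only [simpleTransposition, Equiv.swap_apply_def, Fin.ext_iff]
  split_ifs <;> rfl

theorem simpleTransposition_mul_self {n : ℕ} (i : Fin (n - 1)) :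
    simpleTransposition i * simpleTransposition i = 1 := Equiv.swap_mul_self _ _

/-- Multiplying on the right by `s_i` at an ascent adds exactly one inversion. -/
theorem length_mul_simpleTransposition_of_lt {n : ℕ} (w : Equiv.Perm (Fin n)) (i : Fin (n - 1))
    (h : w ⟨i.val, by omega⟩ < w ⟨i.val + 1, by omega⟩) :
    length (w * simpleTransposition i) = length w + 1 := by
  set s := simpleTransposition i with hs
  have hss : ∀ x, s (s x) = x := fun x => by
    rw [← Equiv.Perm.mul_apply, simpleTransposition_mul_self, Equiv.Perm.one_apply]
  have hval := val_simpleTransposition i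
  rw [← hs] at hval
  -- Applying s to both entries carries inversions of w to inversions of w s; the only ordered pair
  -- whose order s reverses is (i, i + 1), which supplies the one new inversion.
  let e : Fin n × Fin n ≃ Fin n × Fin n := Equiv.prodCongr s s
  have key : (Finset.univ.filter fun p : Fin n × Fin n =>
        p.1 < p.2 ∧ (w * s) p.2 < (w * s) p.1) =
      insert (⟨i.val, by omega⟩, ⟨i.val + 1, by omega⟩)
        ((Finset.univ.filter fun p : Fin n × Fin n =>
          p.1 < p.2 ∧ w p.2 < w p.1).map e.toEmbedding) := by
    ext ⟨p, q⟩
    have hsymm : e.symm (p, q) = (s p, s q) := by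
      rw [Equiv.symm_apply_eq]
      simp [e, hss]
    rw [Finset.mem_filter, Finset.mem_insert, Finset.mem_map_equiv, Finset.mem_filter, hsymm]
    simp only [Finset.mem_univ, true_and, Equiv.Perm.mul_apply, Prod.mk.injEq]
    have hp := hval p
    have hq := hval q
    constructor
    · rintro ⟨h1, h2⟩
      by_cases hpq : p.val = i.val ∧ q.val = i.val + 1
      · exact Or.inl ⟨Fin.ext hpq.1, Fin.ext hpq.2⟩
      · refine Or.inr ⟨?_, h2⟩
        rw [Fin.lt_def] at h1 ⊢
        grind
    · rintro (⟨rfl, rfl⟩ | ⟨h1, h2⟩)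
      · refine ⟨by simp [Fin.lt_def], ?_⟩
        have e1 : s ⟨i.val, by omega⟩ = ⟨i.val + 1, by omega⟩ := Fin.ext (by simp [hval])
        have e2 : s ⟨i.val + 1, by omega⟩ = ⟨i.val, by omega⟩ := Fin.ext (by simp [hval])
        rwa [e1, e2]
      · refine ⟨?_, h2⟩
        by_contra hlt
        by_cases hpq : q.val = i.val ∧ p.val = i.val + 1
        · have e1 : s p = ⟨i.val, by omega⟩ := Fin.ext (by simp [hval, hpq.2])
          have e2 : s q = ⟨i.val + 1, by omega⟩ := Fin.ext (by simp [hval, hpq.1])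
          rw [e1, e2] at h2
          exact absurd h (not_lt.mpr h2.le)
        · rw [Fin.lt_def] at h1 hlt
          grind
  unfold length
  rw [key, Finset.card_insert_of_notMem, Finset.card_map]
  simp only [Finset.mem_map_equiv, Finset.mem_filter, Finset.mem_univ, true_and]
  rintro ⟨h1, -⟩
  have h2 : (s ⟨i.val, by omega⟩).val < (s ⟨i.val + 1, by omega⟩).val := h1
  rw [hval, hval] at h2
  simp at h2

theorem length_mul_simpleTransposition_of_gt {n : ℕ} (w : Equiv.Perm (Fin n)) (i : Fin (n - 1))
    (h : w ⟨i.val + 1, by omega⟩ < w ⟨i.val, by omega⟩) :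
    length w = length (w * simpleTransposition i) + 1 := by
  have := length_mul_simpleTransposition_of_lt (w * simpleTransposition i) i (by
    simpa [simpleTransposition] using h)
  rwa [mul_assoc, simpleTransposition_mul_self, mul_one] at this

theorem length_one {n : ℕ} : length (1 : Equiv.Perm (Fin n)) = 0 := by
  simp only [length, Finset.card_eq_zero, Finset.filter_eq_empty_iff]
  rintro ⟨p, q⟩ - ⟨h1, h2⟩
  exact absurd h1 (not_lt.mpr (le_of_lt h2))

theorem lt_or_gt_simple {n : ℕ} (w : Equiv.Perm (Fin n)) (i : Fin (n - 1)) :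
    w ⟨i.val, by omega⟩ < w ⟨i.val + 1, by omega⟩ ∨
      w ⟨i.val + 1, by omega⟩ < w ⟨i.val, by omega⟩ :=
  lt_or_gt_of_ne fun h => by simpa [Fin.ext_iff] using w.injective h

/-- Each letter changes the length by one, up or down. The reversal makes the head of `r` the last
letter of the word, where right multiplication applies. -/
theorem length_reverse_prod_le {n : ℕ} (r : List (Fin (n - 1))) :
    length (r.reverse.map simpleTransposition).prod ≤ r.length := by
  induction r with
  | nil => simp [length_one]
  | cons i r ih =>
    simp only [List.reverse_cons, List.map_append, List.prod_append, List.map_cons, List.map_nil,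
      List.prod_singleton, List.length_cons]
    rcases lt_or_gt_simple (r.reverse.map simpleTransposition).prod i with h | h
    · rw [length_mul_simpleTransposition_of_lt _ _ h]; omega
    · have := length_mul_simpleTransposition_of_gt _ _ h; omega

theorem isReducedWord_nil_iff {n : ℕ} (w : Equiv.Perm (Fin n)) :
    IsReducedWord w [] ↔ w = 1 := by
  simp only [IsReducedWord, List.map_nil, List.prod_nil, List.length_nil]
  constructor
  · exact fun h => h.1.symm
  · rintro rfl
    exact ⟨rfl, length_one.symm⟩

/-- A word ending in `i` is reduced for `w` iff `i` is a descent of `w` and the word without its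
last letter is reduced for `w s_i`. -/
theorem isReducedWord_append_singleton_iff {n : ℕ} (w : Equiv.Perm (Fin n)) (i : Fin (n - 1))
    (l : List (Fin (n - 1))) :
    IsReducedWord w (l ++ [i]) ↔ w ⟨i.val + 1, by omega⟩ < w ⟨i.val, by omega⟩ ∧
      IsReducedWord (w * simpleTransposition i) l := by
  have hprod : ((l ++ [i]).map simpleTransposition).prod = w ↔
      (l.map simpleTransposition).prod = w * simpleTransposition i := by
    simp only [List.map_append, List.prod_append, List.map_cons, List.map_nil,
      List.prod_singleton]
    constructor
    · rintro rfl
      rw [mul_assoc, simpleTransposition_mul_self, mul_one]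
    · intro h
      rw [h, mul_assoc, simpleTransposition_mul_self, mul_one]
  simp only [IsReducedWord, hprod, List.length_append, List.length_singleton]
  constructor
  · rintro ⟨h1, h2⟩
    have hle := length_reverse_prod_le l.reverse
    rw [List.reverse_reverse, List.length_reverse, h1] at hle
    rcases lt_or_gt_simple w i with h | h
    · have := length_mul_simpleTransposition_of_lt _ _ h
      omega
    · have := length_mul_simpleTransposition_of_gt _ _ h
      exact ⟨h, h1, by omega⟩
  · rintro ⟨h, h1, h2⟩
    have := length_mul_simpleTransposition_of_gt _ _ h
    exact ⟨h1, by omega⟩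

/-! ### Reduced words as descent-removing sequences on functions ℕ → ℕ. -/

/-- `π ∘ s_i` for a function `π` on the natural numbers. -/
def compSwap (π : ℕ → ℕ) (i x : ℕ) : ℕ :=
  if x = i then π (i + 1) else if x = i + 1 then π i else π x

/-- The word `r`, read from right to left, removes descents from the one-line notation
`π 0, …, π (n - 1)` until the identity is reached. -/
def Sorts (n : ℕ) : (ℕ → ℕ) → List ℕ → Prop
  | π, [] => ∀ x < n, π x = x
  | π, i :: r => i + 1 < n ∧ π (i + 1) < π i ∧ Sorts n (compSwap π i) r

/-- The extension of a permutation of `Fin n` to the natural numbers by fixed points. -/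
def natFun {n : ℕ} (w : Equiv.Perm (Fin n)) (x : ℕ) : ℕ :=
  if h : x < n then (w ⟨x, h⟩).val else x

theorem natFun_mul_simpleTransposition {n : ℕ} (w : Equiv.Perm (Fin n)) (i : Fin (n - 1)) :
    natFun (w * simpleTransposition i) = compSwap (natFun w) i.val := by
  funext x
  have hi := i.isLt
  by_cases hx : x < n
  · have hv := val_simpleTransposition i ⟨x, hx⟩
    have hval : natFun (w * simpleTransposition i) x =
        natFun w (simpleTransposition i ⟨x, hx⟩).val := by
      simp [natFun, hx]
    rw [hval, hv]
    simp only [compSwap]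
    split_ifs <;> rfl
  · simp only [natFun, compSwap]
    split_ifs <;> first | rfl | omega

theorem isReducedWord_reverse_iff_sorts {n : ℕ} (r : List (Fin (n - 1)))
    (w : Equiv.Perm (Fin n)) :
    IsReducedWord w r.reverse ↔ Sorts n (natFun w) (r.map Fin.val) := by
  induction r generalizing w with
  | nil =>
    rw [List.reverse_nil, isReducedWord_nil_iff]
    simp only [List.map_nil, Sorts]
    constructor
    · rintro rfl x hx
      simp [natFun, hx]
    · intro h
      ext x
      have := h x x.isLt
      simpa [natFun] using this
  | cons i r ih =>
    have hi := i.isLt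
    rw [List.reverse_cons, isReducedWord_append_singleton_iff, ih, natFun_mul_simpleTransposition]
    simp only [List.map_cons, Sorts]
    have h1 : natFun w (i.val + 1) = (w ⟨i.val + 1, by omega⟩).val :=
      dif_pos (by omega)
    have h2 : natFun w i.val = (w ⟨i.val, by omega⟩).val := dif_pos (by omega)
    rw [h1, h2, Fin.lt_def]
    have h3 : i.val + 1 < n := by omega
    simp [h3]

/-! ### Words of a cycle and of permutations of the last four points. -/

/-- The one-line notation of `s_{m+2} s_{m+1} ⋯ s_t` on `0, …, m + 3`. -/
def cycleFun (m t x : ℕ) : ℕ :=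
  if x < t then x else if x = t then m + 3 else if x ≤ m + 3 then x - 1 else x

/-- The permutation of the four last points given by `a, b, c, d`. -/
def tailFun (m a b c d x : ℕ) : ℕ :=
  if x = m then m + a else if x = m + 1 then m + b else if x = m + 2 then m + c
  else if x = m + 3 then m + d else x

/-- Points below m are fixed and the later values are at least m, so descents below m + 4 can only
sit at m, m + 1, m + 2. Iterating this as a rewrite rule enumerates the words of any such
permutation. -/
theorem sorts_tailFun_iff (m a b c d : ℕ) (r : List ℕ) :
    Sorts (m + 4) (tailFun m a b c d) r ↔
      (r = [] ∧ a = 0 ∧ b = 1 ∧ c = 2 ∧ d = 3) ∨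
      (b < a ∧ ∃ r', r = m :: r' ∧ Sorts (m + 4) (tailFun m b a c d) r') ∨
      (c < b ∧ ∃ r', r = (m + 1) :: r' ∧ Sorts (m + 4) (tailFun m a c b d) r') ∨
      (d < c ∧ ∃ r', r = (m + 2) :: r' ∧ Sorts (m + 4) (tailFun m a b d c) r') := by
  cases r with
  | nil =>
    simp only [Sorts, true_and, reduceCtorEq, false_and, exists_false, and_false, or_false]
    constructor
    · intro h
      have h0 := h m (by omega)
      have h1 := h (m + 1) (by omega)
      have h2 := h (m + 2) (by omega)
      have h3 := h (m + 3) (by omega)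
      simp [tailFun] at h0 h1 h2 h3
      omega
    · rintro ⟨rfl, rfl, rfl, rfl⟩ x hx
      unfold tailFun
      split_ifs <;> omega
  | cons i r =>
    have e0 : compSwap (tailFun m a b c d) m = tailFun m b a c d := by
      funext x; simp only [compSwap, tailFun]; split_ifs <;> omega
    have e1 : compSwap (tailFun m a b c d) (m + 1) = tailFun m a c b d := by
      funext x; simp only [compSwap, tailFun]; split_ifs <;> omega
    have e2 : compSwap (tailFun m a b c d) (m + 2) = tailFun m a b d c := by
      funext x; simp only [compSwap, tailFun]; split_ifs <;> omega
    simp only [Sorts, reduceCtorEq, false_and, false_or, List.cons.injEq]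
    constructor
    · rintro ⟨h1, h2, h3⟩
      have hi : (i = m ∧ b < a) ∨ (i = m + 1 ∧ c < b) ∨ (i = m + 2 ∧ d < c) := by
        clear h3
        simp only [tailFun] at h2
        split_ifs at h2 <;> omega
      rcases hi with ⟨rfl, h⟩ | ⟨rfl, h⟩ | ⟨rfl, h⟩
      · exact Or.inl ⟨h, r, ⟨rfl, rfl⟩, e0 ▸ h3⟩
      · exact Or.inr (Or.inl ⟨h, r, ⟨rfl, rfl⟩, e1 ▸ h3⟩)
      · exact Or.inr (Or.inr ⟨h, r, ⟨rfl, rfl⟩, e2 ▸ h3⟩)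
    · rintro (⟨h, r', ⟨rfl, rfl⟩, h3⟩ | ⟨h, r', ⟨rfl, rfl⟩, h3⟩ | ⟨h, r', ⟨rfl, rfl⟩, h3⟩)
      · exact ⟨by omega, by simpa [tailFun] using h, e0 ▸ h3⟩
      · exact ⟨by omega, by simp only [tailFun]; split_ifs <;> omega, e1 ▸ h3⟩
      · exact ⟨by omega, by simp only [tailFun]; split_ifs <;> omega, e2 ▸ h3⟩

theorem sorts_tailFun_id (m : ℕ) (r : List ℕ) :
    Sorts (m + 4) (tailFun m 0 1 2 3) r ↔ r = [] := by
  rw [sorts_tailFun_iff]; simp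

theorem sorts_tailFun_1023 (m : ℕ) (r : List ℕ) :
    Sorts (m + 4) (tailFun m 1 0 2 3) r ↔ r = [m] := by
  rw [sorts_tailFun_iff]; simp [sorts_tailFun_id]

theorem sorts_tailFun_0132 (m : ℕ) (r : List ℕ) :
    Sorts (m + 4) (tailFun m 0 1 3 2) r ↔ r = [m + 2] := by
  rw [sorts_tailFun_iff]; simp [sorts_tailFun_id]

theorem sorts_tailFun_1032 (m : ℕ) (r : List ℕ) :
    Sorts (m + 4) (tailFun m 1 0 3 2) r ↔ r = [m, m + 2] ∨ r = [m + 2, m] := by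
  rw [sorts_tailFun_iff]; simp [sorts_tailFun_1023, sorts_tailFun_0132]

theorem sorts_tailFun_1302 (m : ℕ) (r : List ℕ) :
    Sorts (m + 4) (tailFun m 1 3 0 2) r ↔
      r = [m + 1, m, m + 2] ∨ r = [m + 1, m + 2, m] := by
  rw [sorts_tailFun_iff]; simp [sorts_tailFun_1032]
  aesop

theorem sorts_tailFun_1203 (m : ℕ) (r : List ℕ) :
    Sorts (m + 4) (tailFun m 1 2 0 3) r ↔ r = [m + 1, m] := by
  rw [sorts_tailFun_iff]; simp [sorts_tailFun_1023]

theorem sorts_tailFun_1230 (m : ℕ) (r : List ℕ) :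
    Sorts (m + 4) (tailFun m 1 2 3 0) r ↔ r = [m + 2, m + 1, m] := by
  rw [sorts_tailFun_iff]; simp [sorts_tailFun_1203]

theorem sorts_tailFun_1320 (m : ℕ) (r : List ℕ) :
    Sorts (m + 4) (tailFun m 1 3 2 0) r ↔ r = [m + 1, m + 2, m + 1, m] ∨
      r = [m + 2, m + 1, m, m + 2] ∨ r = [m + 2, m + 1, m + 2, m] := by
  rw [sorts_tailFun_iff]; simp [sorts_tailFun_1302, sorts_tailFun_1230]
  aesop

theorem compSwap_compSwap_self (π : ℕ → ℕ) (i : ℕ) : compSwap (compSwap π i) i = π := by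
  funext x
  by_cases h : x = i
  · simp [compSwap, h]
  · by_cases h' : x = i + 1 <;> simp [compSwap, h, h']

theorem compSwap_comm (π : ℕ → ℕ) {i j : ℕ} (h : i + 1 < j) :
    compSwap (compSwap π j) i = compSwap (compSwap π i) j := by
  funext x
  have h1 : ¬ i = j := by omega
  have h2 : ¬ i = j + 1 := by omega
  have h3 : ¬ i + 1 = j := by omega
  have h4 : ¬ j = i := by omega
  have h5 : ¬ j = i + 1 := by omega
  have h6 : ¬ j + 1 = i := by omega
  by_cases hi : x = i
  · simp [compSwap, *]
  by_cases hi' : x = i + 1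
  · simp [compSwap, *]
  by_cases hj : x = j <;> by_cases hj' : x = j + 1 <;> simp [compSwap, *]

theorem compSwap_cycleFun (m t : ℕ) (ht : t < m + 3) :
    compSwap (cycleFun m t) t = cycleFun m (t + 1) := by
  funext x; simp only [compSwap, cycleFun]; split_ifs <;> omega

/-- The only descent is at t, and removing it advances t by one, so the word is forced. -/
theorem sorts_cycleFun_iff (m : ℕ) (r : List ℕ) (t : ℕ) (ht : t ≤ m + 3) :
    Sorts (m + 4) (cycleFun m t) r ↔ r = List.range' t (m + 3 - t) := by
  induction r generalizing t with
  | nil =>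
    simp only [Sorts]
    constructor
    · intro h
      have := h t (by omega)
      simp only [cycleFun] at this
      have : t = m + 3 := by split_ifs at this <;> omega
      simp [this]
    · intro h
      have := congrArg List.length h
      simp at this
      intro x hx
      simp only [cycleFun]
      split_ifs <;> omega
  | cons i r ih =>
    simp only [Sorts]
    constructor
    · rintro ⟨h1, h2, h3⟩
      have hi : i = t ∧ t < m + 3 := by
        clear h3
        simp only [cycleFun] at h2
        split_ifs at h2 <;> omega
      obtain ⟨rfl, hi⟩ := hi
      rw [compSwap_cycleFun _ _ hi, ih _ (by omega)] at h3
      rw [h3, show m + 3 - i = m + 3 - (i + 1) + 1 by omega, List.range'_succ]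
    · intro h
      have hlt : t < m + 3 := by
        have := congrArg List.length h
        simp at this
        omega
      rw [show m + 3 - t = m + 3 - (t + 1) + 1 by omega, List.range'_succ, List.cons.injEq] at h
      obtain ⟨rfl, h⟩ := h
      refine ⟨by omega, ?_, ?_⟩
      · simp only [cycleFun]; split_ifs <;> omega
      · rw [compSwap_cycleFun _ _ hlt, ih _ (by omega)]; exact h

theorem compSwap_cycleFun_apply (m t x : ℕ) (ht : t ≤ m) :
    compSwap (cycleFun m t) (m + 1) x =
      if x < t then x else if x = t then m + 3 else if x ≤ m then x - 1
      else if x = m + 1 then m + 1 else if x = m + 2 then m else if x = m + 3 then m + 2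
      else x := by
  simp only [compSwap, cycleFun]; split_ifs <;> omega

theorem compSwap_compSwap_cycleFun_apply (m t x : ℕ) (ht : t ≤ m) :
    compSwap (compSwap (cycleFun m t) (m + 1)) (m + 2) x =
      if x < t then x else if x = t then m + 3 else if x ≤ m then x - 1
      else if x = m + 3 then m else x := by
  rw [compSwap]
  simp only [compSwap_cycleFun_apply m t _ ht]
  split_ifs <;> omega

/-! ### Enumeration of the reduced words by pairs j ≤ k. -/

/-- The letter in position `i` (counted from the right) of the reduced word of `ₙw`, `n = m + 4`,
with parameters `j ≤ k ≤ m + 2`. -/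
def wordLetter (m k j i : ℕ) : ℕ :=
  if i < j then i
  else if i = j then m + 2
  else if i < m + 3 ∧ i ≤ k then i - 1
  else if k ≤ m then (if i = k + 1 then m + 1 else i - 2)
  else if k = m + 1 then (if i = m + 2 then m + 1 else if i = m + 3 then m else m + 2)
  else if i = m + 3 then (if j = m + 2 then m + 1 else m + 2)
  else m

/-- Both drifting letters lie before position i, so the run 0, 1, … is delayed by two places. -/
theorem wordLetter_of_add_two_le {m k j i : ℕ} (hj : j ≤ k) (hk : k ≤ m) (hi : k + 2 ≤ i) :
    wordLetter m k j i = i - 2 := by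
  unfold wordLetter
  rw [if_neg (by omega), if_neg (by omega), if_neg (by omega), if_pos hk, if_neg (by omega)]

/-- The words of `s_{m+2} ⋯ s_t s_{m+1}`, read from right to left. -/
theorem sorts_compSwap_cycleFun_iff (m d : ℕ) (t : ℕ) (ht : t + d = m) (r : List ℕ) :
    Sorts (m + 4) (compSwap (cycleFun m t) (m + 1)) r ↔
      ∃ k, t ≤ k ∧ k ≤ m + 2 ∧
        r = (List.range' (t + 1) (m + 4 - t)).map (wordLetter m k t) := by
  induction d generalizing t r with
  -- For t = m only the last four points move, as 3102: one word through 3012 and two through 1302,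
  -- matching k = m, m + 1, m + 2.
  | zero =>
    obtain rfl : t = m := by omega
    have e : compSwap (cycleFun t t) (t + 1) = tailFun t 3 1 0 2 := by
      funext x; simp only [compSwap, tailFun, cycleFun]; split_ifs <;> omega
    have h3012 (r : List ℕ) : Sorts (t + 4) (tailFun t 3 0 1 2) r ↔ r = [t, t + 1, t + 2] := by
      have e : cycleFun t t = tailFun t 3 0 1 2 := by
        funext x; simp only [tailFun, cycleFun]; split_ifs <;> omega
      rw [← e, sorts_cycleFun_iff _ _ _ (by omega), show t + 3 - t = 3 by omega]
      simp [List.range'_succ]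
    rw [e, sorts_tailFun_iff]
    simp only [h3012, sorts_tailFun_1302]
    have hk : ∀ P : ℕ → Prop, (∃ k, t ≤ k ∧ k ≤ t + 2 ∧ P k) ↔ P t ∨ P (t + 1) ∨ P (t + 2) := by
      intro P
      constructor
      · rintro ⟨k, h1, h2, h⟩
        obtain rfl | rfl | rfl : k = t ∨ k = t + 1 ∨ k = t + 2 := by omega
        all_goals simp [h]
      · rintro (h | h | h)
        · exact ⟨t, by omega, by omega, h⟩
        · exact ⟨t + 1, by omega, by omega, h⟩
        · exact ⟨t + 2, by omega, by omega, h⟩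
    rw [hk, show t + 4 - t = 4 by omega]
    have hr : List.range' (t + 1) 4 = [t + 1, t + 2, t + 3, t + 4] := rfl
    rw [hr]
    simp [wordLetter]
    grind
  | succ d ih =>
    cases r with
    | nil =>
      simp only [Sorts]
      constructor
      · intro h
        have := h t (by omega)
        simp only [compSwap_cycleFun_apply m t _ (show t ≤ m by omega)] at this
        split_ifs at this <;> omega
      · rintro ⟨k, h1, h2, h3⟩
        have := congrArg List.length h3
        simp at this
        omega
    | cons i r =>
      have eb : compSwap (compSwap (cycleFun m t) (m + 1)) (m + 1) = cycleFun m t :=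
        compSwap_compSwap_self _ _
      have et : compSwap (compSwap (cycleFun m t) (m + 1)) t =
          compSwap (cycleFun m (t + 1)) (m + 1) := by
        rw [compSwap_comm _ (by omega), compSwap_cycleFun _ _ (by omega)]
      have hlen : m + 4 - t = (m + 4 - (t + 1)) + 1 := by omega
      -- Case k = t: the letter m + 1 is taken off now, and the rest is the forced word of the
      -- cycle.
      have hb : (List.range' (t + 1 + 1) (m + 4 - (t + 1))).map (wordLetter m t t) =
          List.range' t (m + 3 - t) := by
        apply List.ext_getElem
        · simp
        · intro q h1 h2
          rw [List.getElem_map, List.getElem_range', List.getElem_range',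
            wordLetter_of_add_two_le] <;> omega
      -- Case k > t: from position t + 2 on, the letters do not depend on whether m + 2 stood at
      -- position t or t + 1, so the words for t + 1 can be reused.
      have hm (k : ℕ) (hk : t + 1 ≤ k) :
          (List.range' (t + 1 + 1) (m + 4 - (t + 1))).map (wordLetter m k t) =
          (List.range' (t + 1 + 1) (m + 4 - (t + 1))).map (wordLetter m k (t + 1)) := by
        apply List.map_congr_left
        intro q hq
        simp only [List.mem_range'_1] at hq
        simp [wordLetter, show ¬ t = m + 2 by omega, show ¬ t = m + 1 by omega, show ¬ q < t by omega, show ¬ q = t by omega,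
          show ¬ q < t + 1 by omega, show ¬ q = t + 1 by omega]
      simp only [Sorts, hlen, List.range'_succ, List.map_cons, List.cons.injEq]
      constructor
      · rintro ⟨h1, h2, h3⟩
        have hi : i = t ∨ i = m + 1 := by
          clear h3
          simp only [compSwap_cycleFun_apply m t _ (show t ≤ m by omega)] at h2
          clear ih eb et hb hm
          grind
        rcases hi with rfl | rfl
        · rw [et, ih _ (by omega)] at h3
          obtain ⟨k, hk1, hk2, h3⟩ := h3
          refine ⟨k, by omega, hk2, ?_, ?_⟩
          · simp only [wordLetter]
            split_ifs <;> omega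
          · rw [h3, hm _ hk1]
        · rw [eb, sorts_cycleFun_iff _ _ _ (by omega)] at h3
          refine ⟨t, by omega, by omega, ?_, ?_⟩
          · simp only [wordLetter]
            split_ifs <;> omega
          · rw [h3, hb]
      · rintro ⟨k, hk1, hk2, rfl, rfl⟩
        rcases Nat.eq_or_lt_of_le hk1 with rfl | hk
        · have : wordLetter m t t (t + 1) = m + 1 := by
            simp only [wordLetter]; split_ifs <;> omega
          rw [this, eb, hb, sorts_cycleFun_iff _ _ _ (by omega)]
          refine ⟨by omega, ?_, rfl⟩
          simp only [compSwap_cycleFun_apply m t _ (show t ≤ m by omega)]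
          split_ifs <;> omega
        · have : wordLetter m k t (t + 1) = t := by
            simp only [wordLetter]; split_ifs <;> omega
          rw [this, et, ih _ (by omega)]
          refine ⟨by omega, ?_, k, by omega, hk2, hm _ hk⟩
          simp only [compSwap_cycleFun_apply m t _ (show t ≤ m by omega)]
          split_ifs <;> omega

/-- The descents are t and m + 2. Removing m + 2 fixes j = t and leaves the words indexed by k
alone; removing t means j > t and leads to the same situation for t + 1, or to 1320 on the last four
points when t = m. Positions are counted from t, as if 0, …, t - 1 had already been read, so that
one `wordLetter` serves every t. -/
theorem sorts_compSwap_compSwap_cycleFun_iff (m d : ℕ) (t : ℕ) (ht : t + d = m) (r : List ℕ) :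
    Sorts (m + 4) (compSwap (compSwap (cycleFun m t) (m + 1)) (m + 2)) r ↔
      ∃ k j, t ≤ j ∧ j ≤ k ∧ k ≤ m + 2 ∧
        r = (List.range' t (m + 5 - t)).map (wordLetter m k j) := by
  cases r with
  | nil =>
    simp only [Sorts]
    constructor
    · intro h
      have := h t (by omega)
      simp only [compSwap_compSwap_cycleFun_apply m t _ (show t ≤ m by omega)] at this
      split_ifs at this <;> omega
    · rintro ⟨k, j, h1, h2, h3, h4⟩
      have := congrArg List.length h4
      simp at this
      omega
  | cons i r =>
    have ea : compSwap (compSwap (compSwap (cycleFun m t) (m + 1)) (m + 2)) (m + 2) =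
        compSwap (cycleFun m t) (m + 1) := compSwap_compSwap_self _ _
    have hlen : m + 5 - t = (m + 4 - t) + 1 := by omega
    have hdesc : ∀ i, i + 1 < m + 4 →
        compSwap (compSwap (cycleFun m t) (m + 1)) (m + 2) (i + 1) <
          compSwap (compSwap (cycleFun m t) (m + 1)) (m + 2) i → i = t ∨ i = m + 2 := by
      intro i h1 h2
      simp only [compSwap_compSwap_cycleFun_apply m t _ (show t ≤ m by omega)] at h2
      split_ifs at h2 <;> omega
    have hdesct : compSwap (compSwap (cycleFun m t) (m + 1)) (m + 2) (t + 1) <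
          compSwap (compSwap (cycleFun m t) (m + 1)) (m + 2) t := by
      simp only [compSwap_compSwap_cycleFun_apply m t _ (show t ≤ m by omega)]
      split_ifs <;> omega
    have hdesca : compSwap (compSwap (cycleFun m t) (m + 1)) (m + 2) (m + 2 + 1) <
          compSwap (compSwap (cycleFun m t) (m + 1)) (m + 2) (m + 2) := by
      simp only [compSwap_compSwap_cycleFun_apply m t _ (show t ≤ m by omega)]
      split_ifs <;> omega
    have hhead (k j : ℕ) (hj : t < j) : wordLetter m k j t = t := by
      simp [wordLetter, hj]
    have hhead' (k : ℕ) : wordLetter m k t t = m + 2 := by simp [wordLetter]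
    have htail : Sorts (m + 4) (compSwap (compSwap (compSwap (cycleFun m t) (m + 1)) (m + 2)) t) r
        ↔ ∃ k j, t + 1 ≤ j ∧ j ≤ k ∧ k ≤ m + 2 ∧
          r = (List.range' (t + 1) (m + 4 - t)).map (wordLetter m k j) := by
      cases d with
      | zero =>
        obtain rfl : t = m := by omega
        have e : compSwap (compSwap (compSwap (cycleFun t t) (t + 1)) (t + 2)) t =
            tailFun t 1 3 2 0 := by
          funext x
          rw [compSwap]
          simp only [compSwap_compSwap_cycleFun_apply t t _ le_rfl, tailFun]
          split_ifs <;> omega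
        have hr : List.range' (t + 1) 4 = [t + 1, t + 2, t + 3, t + 4] := rfl
        rw [e, sorts_tailFun_1320, show t + 4 - t = 4 by omega, hr]
        constructor
        · rintro (h | h | h)
          · exact ⟨t + 2, t + 2, by omega, by omega, by omega, by
              simp [h, wordLetter]⟩
          · exact ⟨t + 1, t + 1, by omega, by omega, by omega, by
              simp [h, wordLetter]⟩
          · exact ⟨t + 2, t + 1, by omega, by omega, by omega, by
              simp [h, wordLetter]⟩
        · rintro ⟨k, j, h1, h2, h3, rfl⟩
          obtain ⟨rfl, rfl⟩ | ⟨rfl, rfl⟩ | ⟨rfl, rfl⟩ : (k = t + 1 ∧ j = t + 1) ∨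
              (k = t + 2 ∧ j = t + 1) ∨ (k = t + 2 ∧ j = t + 2) := by omega
          all_goals simp [wordLetter]
      | succ d =>
        have et : compSwap (compSwap (compSwap (cycleFun m t) (m + 1)) (m + 2)) t =
            compSwap (compSwap (cycleFun m (t + 1)) (m + 1)) (m + 2) := by
          rw [compSwap_comm _ (show t + 1 < m + 2 by omega),
            compSwap_comm _ (show t + 1 < m + 1 by omega),
            compSwap_cycleFun _ _ (by omega)]
        rw [et, sorts_compSwap_compSwap_cycleFun_iff m d (t + 1) (by omega),
          show m + 5 - (t + 1) = m + 4 - t by omega]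
    simp only [Sorts, hlen, List.range'_succ, List.map_cons, List.cons.injEq]
    constructor
    · rintro ⟨h1, h2, h3⟩
      rcases hdesc i h1 h2 with rfl | rfl
      · obtain ⟨k, j, hj, hk, hk2, h⟩ := htail.mp h3
        exact ⟨k, j, by omega, hk, hk2, (hhead k j hj).symm, h⟩
      · rw [ea, sorts_compSwap_cycleFun_iff m d t ht] at h3
        obtain ⟨k, hk, hk2, h⟩ := h3
        exact ⟨k, t, by omega, hk, hk2, (hhead' k).symm, h⟩
    · rintro ⟨k, j, hj, hk, hk2, rfl, h⟩
      rcases Nat.eq_or_lt_of_le hj with rfl | hj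
      · rw [hhead', ea, sorts_compSwap_cycleFun_iff m d t ht]
        exact ⟨by omega, hdesca, k, hk, hk2, h⟩
      · rw [hhead _ _ hj, htail]
        exact ⟨by omega, hdesct, k, j, hj, hk, hk2, h⟩

theorem natFun_nw (m : ℕ) (hn : 4 ≤ m + 4) : natFun (nw (m + 4) hn) =
    compSwap (compSwap (cycleFun m 0) (m + 1)) (m + 2) := by
  funext x
  rw [compSwap_compSwap_cycleFun_apply m 0 x (Nat.zero_le _)]
  by_cases hx : x < m + 4
  · simp only [natFun, nw, Equiv.coe_fn_mk, hx, dite_true, apply_ite Fin.val]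
    split_ifs <;> omega
  · simp only [natFun, hx, dite_false]
    split_ifs <;> omega

/-- The reduced words of `ₙw` are the words with letters `wordLetter m k j`, `j ≤ k ≤ n - 2`. -/
theorem isReducedWord_nw_reverse_iff (m : ℕ) (hn : 4 ≤ m + 4) (r : List (Fin (m + 3))) :
    IsReducedWord (nw (m + 4) hn) r.reverse ↔
      ∃ k j, j ≤ k ∧ k ≤ m + 2 ∧ r.map Fin.val = (List.range (m + 5)).map (wordLetter m k j) := by
  have := isReducedWord_reverse_iff_sorts r (nw (m + 4) hn)
  rw [natFun_nw, sorts_compSwap_compSwap_cycleFun_iff m m 0 (by omega)] at this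
  simpa [List.range_eq_range'] using this

/-! ### Moves expressed position by position. -/

theorem CommutationMove.reverse {m : ℕ} {a b : List (Fin m)} (h : CommutationMove a b) :
    CommutationMove a.reverse b.reverse := by
  obtain ⟨u, v, i, j, hij, rfl, rfl⟩ := h
  exact ⟨v.reverse, u.reverse, j, i, hij.symm, by simp, by simp⟩

theorem BraidMove.reverse {m : ℕ} {a b : List (Fin m)} (h : BraidMove a b) :
    BraidMove a.reverse b.reverse := by
  obtain ⟨u, v, i, j, hij, rfl, rfl⟩ := h
  exact ⟨v.reverse, u.reverse, i, j, hij, by simp, by simp⟩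

theorem range_eq_append_range' (p d e : ℕ) :
    List.range (p + d + e) = List.range p ++ List.range' p d ++ List.range' (p + d) e := by
  rw [List.range_eq_range', List.range_eq_range', List.append_assoc]
  have h1 := List.range'_append (s := p) (m := d) (n := e) (step := 1)
  have h2 := List.range'_append (s := 0) (m := p) (n := d + e) (step := 1)
  simp only [one_mul, zero_add] at h1 h2
  rw [h1, h2, add_assoc]

/-- Here p is the length of the untouched prefix; replacing lists by functions of the position turns
the comparison of words into arithmetic. -/
theorem commutationMove_map_range_iff {m L : ℕ} (F G : ℕ → Fin m) :
    CommutationMove ((List.range L).map F) ((List.range L).map G) ↔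
      ∃ p, p + 1 < L ∧
        ((F p).val + 1 < (F (p + 1)).val ∨ (F (p + 1)).val + 1 < (F p).val) ∧
        G p = F (p + 1) ∧ G (p + 1) = F p ∧
        ∀ i < L, i ≠ p → i ≠ p + 1 → G i = F i := by
  constructor
  · rintro ⟨u, v, x, y, hxy, hF, hG⟩
    have hlen : L = u.length + 2 + v.length := by
      have := congrArg List.length hF
      simp at this
      omega
    have hF' : ∀ i < L, (u ++ [x, y] ++ v)[i]? = some (F i) := fun i hi => by
      rw [← hF]; simp [hi]
    have hG' : ∀ i < L, (u ++ [y, x] ++ v)[i]? = some (G i) := fun i hi => by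
      rw [← hG]; simp [hi]
    have f0 := hF' u.length (by omega)
    have f1 := hF' (u.length + 1) (by omega)
    have g0 := hG' u.length (by omega)
    have g1 := hG' (u.length + 1) (by omega)
    simp at f0 f1 g0 g1
    refine ⟨u.length, by omega, by rwa [← f0, ← f1], by rw [← g0, ← f1], by rw [← g1, ← f0], ?_⟩
    intro i hi h0 h1
    have hf := hF' i hi
    have hg := hG' i hi
    apply Option.some_injective
    rw [← hf, ← hg]
    rcases lt_or_ge i u.length with h | h
    · simp [List.getElem?_append_left h]
    · obtain ⟨q, rfl⟩ : ∃ q, i = u.length + (q + 2) := ⟨i - u.length - 2, by omega⟩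
      simp [List.getElem?_append_right]
  · rintro ⟨p, hp, hfar, h0, h1, hrest⟩
    obtain ⟨e, rfl⟩ : ∃ e, L = p + 2 + e := ⟨L - (p + 2), by omega⟩
    have hr : List.range' p 2 = [p, p + 1] := rfl
    refine ⟨(List.range p).map F, (List.range' (p + 2) e).map F, F p, F (p + 1), hfar, ?_, ?_⟩
    · rw [range_eq_append_range', hr]; simp
    · have hu : (List.range p).map G = (List.range p).map F := List.map_congr_left fun i hi => by
        rw [List.mem_range] at hi
        exact hrest i (by omega) (by omega) (by omega)
      have hv : (List.range' (p + 2) e).map G = (List.range' (p + 2) e).map F :=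
        List.map_congr_left fun i hi => by
          rw [List.mem_range'_1] at hi
          exact hrest i (by omega) (by omega) (by omega)
      rw [range_eq_append_range', hr]
      simp [hu, hv, h0, h1]

theorem braidMove_map_range_iff {m L : ℕ} (F G : ℕ → Fin m) :
    BraidMove ((List.range L).map F) ((List.range L).map G) ↔
      ∃ p, p + 2 < L ∧
        ((F p).val + 1 = (F (p + 1)).val ∨ (F (p + 1)).val + 1 = (F p).val) ∧
        F (p + 2) = F p ∧ G p = F (p + 1) ∧ G (p + 1) = F p ∧ G (p + 2) = F (p + 1) ∧
        ∀ i < L, i ≠ p → i ≠ p + 1 → i ≠ p + 2 → G i = F i := by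
  constructor
  · rintro ⟨u, v, x, y, hxy, hF, hG⟩
    have hlen : L = u.length + 3 + v.length := by
      have := congrArg List.length hF
      simp at this
      omega
    have hF' : ∀ i < L, (u ++ [x, y, x] ++ v)[i]? = some (F i) := fun i hi => by
      rw [← hF]; simp [hi]
    have hG' : ∀ i < L, (u ++ [y, x, y] ++ v)[i]? = some (G i) := fun i hi => by
      rw [← hG]; simp [hi]
    have f0 := hF' u.length (by omega)
    have f1 := hF' (u.length + 1) (by omega)
    have f2 := hF' (u.length + 2) (by omega)
    have g0 := hG' u.length (by omega)
    have g1 := hG' (u.length + 1) (by omega)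
    have g2 := hG' (u.length + 2) (by omega)
    simp at f0 f1 f2 g0 g1 g2
    refine ⟨u.length, by omega, by rwa [← f0, ← f1], by rw [← f2, ← f0], by rw [← g0, ← f1],
      by rw [← g1, ← f0], by rw [← g2, ← f1], ?_⟩
    intro i hi h0 h1 h2
    have hf := hF' i hi
    have hg := hG' i hi
    apply Option.some_injective
    rw [← hf, ← hg]
    rcases lt_or_ge i u.length with h | h
    · simp [List.getElem?_append_left h]
    · obtain ⟨q, rfl⟩ : ∃ q, i = u.length + (q + 3) := ⟨i - u.length - 3, by omega⟩
      simp [List.getElem?_append_right]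
  · rintro ⟨p, hp, hnear, hF, h0, h1, h2, hrest⟩
    obtain ⟨e, rfl⟩ : ∃ e, L = p + 3 + e := ⟨L - (p + 3), by omega⟩
    have hr : List.range' p 3 = [p, p + 1, p + 2] := rfl
    refine ⟨(List.range p).map F, (List.range' (p + 3) e).map F, F p, F (p + 1), hnear, ?_, ?_⟩
    · rw [range_eq_append_range', hr]; simp [hF]
    · have hu : (List.range p).map G = (List.range p).map F := List.map_congr_left fun i hi => by
        rw [List.mem_range] at hi
        exact hrest i (by omega) (by omega) (by omega) (by omega)
      have hv : (List.range' (p + 3) e).map G = (List.range' (p + 3) e).map F :=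
        List.map_congr_left fun i hi => by
          rw [List.mem_range'_1] at hi
          exact hrest i (by omega) (by omega) (by omega) (by omega)
      rw [range_eq_append_range', hr]
      simp [hu, hv, h0, h1, h2]

/-! ### Positions at which two words differ, and why only neighbouring cells are joined. -/

section wordLetter

variable {m k j i : ℕ}

theorem wordLetter_lt (hk : k ≤ m + 2) (hj : j ≤ k) (hi : i < m + 5) :
    wordLetter m k j i < m + 3 := by
  unfold wordLetter
  split_ifs <;> omega

theorem wordLetter_of_lt (h : i < j) : wordLetter m k j i = i := if_pos h

theorem wordLetter_self : wordLetter m k j j = m + 2 := by simp [wordLetter]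

theorem wordLetter_of_mem (h1 : j < i) (h2 : i ≤ k) (h3 : i < m + 3) :
    wordLetter m k j i = i - 1 := by
  rw [wordLetter, if_neg (by omega), if_neg (by omega), if_pos ⟨h3, h2⟩]

theorem wordLetter_add_one (hj : j ≤ k) (hk : k ≤ m + 1) : wordLetter m k j (k + 1) = m + 1 := by
  rw [wordLetter, if_neg (by omega), if_neg (by omega), if_neg (by omega)]
  split_ifs <;> omega

theorem wordLetter_of_eq_add_one (hj : j ≤ m + 1) :
    wordLetter m (m + 1) j (m + 3) = m ∧ wordLetter m (m + 1) j (m + 4) = m + 2 := by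
  constructor <;> rw [wordLetter, if_neg (by omega), if_neg (by omega), if_neg (by omega)] <;> simp

theorem wordLetter_of_eq_add_two (hj : j ≤ m + 2) :
    wordLetter m (m + 2) j (m + 3) = (if j = m + 2 then m + 1 else m + 2) ∧
      wordLetter m (m + 2) j (m + 4) = m := by
  constructor <;> rw [wordLetter, if_neg (by omega), if_neg (by omega), if_neg (by omega)] <;> simp

end wordLetter

/-- Positions at which two of the words differ. -/
theorem wordLetter_ne {m k j k' j' : ℕ} (hj : j ≤ k) (hk : k ≤ m + 2) (hj' : j' ≤ k')
    (hk' : k' ≤ m + 2) :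
    (j < j' → wordLetter m k j j ≠ wordLetter m k' j' j ∧
      wordLetter m k j j' ≠ wordLetter m k' j' j') ∧
    (k < k' → k ≤ m → k + 1 ≠ j' ∧ (k < m ∨ j' < m + 2) →
      wordLetter m k j (k + 1) ≠ wordLetter m k' j' (k + 1)) ∧
    (k < k' → k' ≤ m + 1 → wordLetter m k j (k' + 1) ≠ wordLetter m k' j' (k' + 1)) ∧
    (k ≤ m → k' = m + 1 → wordLetter m k j (m + 3) ≠ wordLetter m k' j' (m + 3)) ∧
    (k ≤ m → k' = m + 2 → wordLetter m k j (m + 2) ≠ wordLetter m k' j' (m + 2)) ∧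
    (k ≤ m + 1 → k' = m + 2 → wordLetter m k j (m + 4) ≠ wordLetter m k' j' (m + 4)) ∧
    (k = m + 1 → k' = m + 2 → wordLetter m k j (m + 3) ≠ wordLetter m k' j' (m + 3)) := by
  refine ⟨fun h => ⟨?_, ?_⟩, fun h1 h2 h3 => ?_, fun h1 h2 => ?_, fun h1 h2 => ?_, fun h1 h2 => ?_,
    fun h1 h2 => ?_, fun h1 h2 => ?_⟩
  · rw [wordLetter_self, wordLetter_of_lt h]; omega
  · rw [wordLetter_self]
    unfold wordLetter
    split_ifs <;> omega
  · rw [wordLetter_add_one hj (by omega)]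
    unfold wordLetter
    split_ifs <;> omega
  · rw [wordLetter_add_one hj' h2]
    unfold wordLetter
    split_ifs <;> omega
  · subst h2
    rw [(wordLetter_of_eq_add_one hj').1, wordLetter_of_add_two_le hj h1 (by omega)]; omega
  · subst h2
    rw [wordLetter_of_add_two_le hj h1 (by omega)]
    unfold wordLetter
    split_ifs <;> omega
  · subst h2
    rw [(wordLetter_of_eq_add_two hj').2]
    rcases Nat.lt_or_ge m k with h | h
    · obtain rfl : k = m + 1 := by omega
      rw [(wordLetter_of_eq_add_one hj).2]; omega
    · rw [wordLetter_of_add_two_le hj h (by omega)]; omega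
  · subst h1 h2
    rw [(wordLetter_of_eq_add_two hj').1, (wordLetter_of_eq_add_one hj).1]
    split_ifs <;> omega

/-- Two cells of the staircase are neighbours. -/
def CellAdj (k j k' j' : ℕ) : Prop :=
  (k = k' ∧ (j + 1 = j' ∨ j' + 1 = j)) ∨ (j = j' ∧ (k + 1 = k' ∨ k' + 1 = k))

section moves

variable {m k j k' j' : ℕ}

/-- If all positions at which two of the words differ satisfy `P`, then so do the positions at
which they are known to differ. -/
theorem differences_mem {P : ℕ → Prop} (hj : j ≤ k) (hk : k ≤ m + 2) (hj' : j' ≤ k')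
    (hk' : k' ≤ m + 2)
    (h : ∀ i < m + 5, wordLetter m k j i ≠ wordLetter m k' j' i → P i) :
    (j < j' → P j ∧ P j') ∧
    (k < k' → k ≤ m → k + 1 ≠ j' ∧ (k < m ∨ j' < m + 2) → P (k + 1)) ∧
    (k < k' → k' ≤ m + 1 → P (k' + 1)) ∧
    (k ≤ m → k' = m + 1 → P (m + 3)) ∧
    (k ≤ m → k' = m + 2 → P (m + 2)) ∧
    (k ≤ m + 1 → k' = m + 2 → P (m + 4)) ∧
    (k = m + 1 → k' = m + 2 → P (m + 3)) := by
  obtain ⟨a1, a2, a3, a4, a5, a6, a7⟩ := wordLetter_ne hj hk hj' hk'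
  exact ⟨fun x => ⟨h j (by omega) (a1 x).1, h j' (by omega) (a1 x).2⟩,
    fun x y z => h (k + 1) (by omega) (a2 x y z), fun x y => h (k' + 1) (by omega) (a3 x y),
    fun x y => h (m + 3) (by omega) (a4 x y), fun x y => h (m + 2) (by omega) (a5 x y),
    fun x y => h (m + 4) (by omega) (a6 x y), fun x y => h (m + 3) (by omega) (a7 x y)⟩

/-- A change of j shows at positions j and j', a change of k near k + 1 and k' + 1 or at the end of
the word; unless the cells are neighbours, these do not fit into two consecutive positions. The
known differences are oriented (j < j', k < k'), hence the use in both directions. -/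
theorem cellAdj_of_two_differences (hj : j ≤ k) (hk : k ≤ m + 2) (hj' : j' ≤ k')
    (hk' : k' ≤ m + 2) (p : ℕ) (hne : ¬ (k = k' ∧ j = j'))
    (h : ∀ i < m + 5, i ≠ p → i ≠ p + 1 → wordLetter m k' j' i = wordLetter m k j i) :
    CellAdj k j k' j' := by
  have c := differences_mem (P := fun i => i = p ∨ i = p + 1) hj hk hj' hk' fun i hi hn => by
    by_contra hc
    push Not at hc
    exact hn (h i hi hc.1 hc.2).symm
  have d := differences_mem (P := fun i => i = p ∨ i = p + 1) hj' hk' hj hk fun i hi hn => by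
    by_contra hc
    push Not at hc
    exact hn (h i hi hc.1 hc.2)
  clear h
  unfold CellAdj
  rcases lt_trichotomy j j' with hjj | hjj | hjj <;>
    rcases lt_trichotomy k k' with hkk | hkk | hkk <;>
    grind

/-- Constraints on a repetition `x y x` in one of the words. -/
theorem wordLetter_eq_add_two {p : ℕ} (hj : j ≤ k) (hk : k ≤ m + 2)
    (hf : wordLetter m k j p = wordLetter m k j (p + 2)) :
    (p = j → m + 1 ≤ j) ∧ p + 2 ≠ j ∧ (p = k + 1 → m ≤ k) ∧
      (k ≤ m + 1 → p + 2 = k + 1 → j < p → False) := by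
  refine ⟨?_, ?_, ?_, ?_⟩
  · rintro rfl
    rw [wordLetter_self] at hf
    unfold wordLetter at hf
    split_ifs at hf <;> omega
  · intro hp
    rw [hp, wordLetter_self, wordLetter_of_lt (by omega)] at hf
    omega
  · rintro rfl
    by_contra hkm
    rw [wordLetter_add_one hj (by omega), wordLetter_of_add_two_le hj (by omega) (by omega)] at hf
    omega
  · intro h1 h2 h3
    rw [h2, wordLetter_add_one hj h1, wordLetter_of_mem h3 (by omega) (by omega)] at hf
    omega

/-- A window of three is not enough by itself: in the generic range, (k, j) and (k, j + 2) differ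
exactly at j, j + 1, j + 2. The equality of the outer letters of a braid, in both words, rules such
pairs out. -/
theorem cellAdj_of_three_differences (hj : j ≤ k) (hk : k ≤ m + 2) (hj' : j' ≤ k')
    (hk' : k' ≤ m + 2) (p : ℕ) (hne : ¬ (k = k' ∧ j = j')) (hp : p + 2 < m + 5)
    (hf : wordLetter m k j p = wordLetter m k j (p + 2))
    (hg : wordLetter m k' j' p = wordLetter m k' j' (p + 2))
    (h : ∀ i < m + 5, i ≠ p → i ≠ p + 1 → i ≠ p + 2 →
      wordLetter m k' j' i = wordLetter m k j i) :
    CellAdj k j k' j' := by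
  have e1 := wordLetter_eq_add_two hj hk hf
  have e2 := wordLetter_eq_add_two hj' hk' hg
  clear hf hg
  have c := differences_mem (P := fun i => p ≤ i ∧ i ≤ p + 2) hj hk hj' hk'
    fun i hi hn => by
      by_contra hc
      exact hn (h i hi (by omega) (by omega) (by omega)).symm
  have d := differences_mem (P := fun i => p ≤ i ∧ i ≤ p + 2) hj' hk' hj hk
    fun i hi hn => by
      by_contra hc
      exact hn (h i hi (by omega) (by omega) (by omega))
  clear h
  obtain ⟨c1, c2, c3, c4, c5, c6, c7⟩ := c
  obtain ⟨d1, d2, d3, d4, d5, d6, d7⟩ := d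
  unfold CellAdj
  -- For k' ≤ m the window contains k + 1 and k' + 1, so k' = k + 2 would force p = k + 1, which
  -- `e1` excludes; for larger k' the differences at the end of the word decide.
  have hcol (hkk : k < k') (hjj : j = j') : k + 1 = k' := by
    clear d1 d2 d3 d4 d5 d6 d7
    rcases Nat.lt_or_ge m k with hkm | hkm
    · omega
    · have q2 := c2 hkk hkm
      rcases Nat.lt_or_ge m k' with hkm' | hkm'
      · clear c1 c2 c3 c7
        obtain rfl | rfl : k' = m + 1 ∨ k' = m + 2 := by omega
        · have := c4 hkm rfl
          omega
        · have := c6 (by omega) rfl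
          have := c5 hkm rfl
          omega
      · have := c3 hkk (by omega)
        clear c1 c2 c3 c4 c5 c6 c7
        omega
  have hcol' (hkk : k' < k) (hjj : j = j') : k' + 1 = k := by
    clear c1 c2 c3 c4 c5 c6 c7 hcol
    rcases Nat.lt_or_ge m k' with hkm | hkm
    · omega
    · have q2 := d2 hkk hkm
      rcases Nat.lt_or_ge m k with hkm' | hkm'
      · clear d1 d2 d3 d7
        obtain rfl | rfl : k = m + 1 ∨ k = m + 2 := by omega
        · have := d4 hkm rfl
          omega
        · have := d6 (by omega) rfl
          have := d5 hkm rfl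
          omega
      · have := d3 hkk (by omega)
        clear d1 d2 d3 d4 d5 d6 d7
        omega
  rcases lt_trichotomy j j' with hjj | hjj | hjj
  · have := c1 hjj
    rcases lt_trichotomy k k' with hkk | hkk | hkk
    · clear d1 d2 d3 d4 d5 d6 d7 hcol hcol'
      omega
    · clear d1 d2 d3 d4 d5 d6 d7 c2 c3 c4 c5 c6 c7
      omega
    · clear c2 c3 c4 c5 c6 c7 d1 hcol hcol'
      omega
  · clear c1 c2 c3 c4 c5 c6 c7 d1 d2 d3 d4 d5 d6 d7 e1 e2
    omega
  · have := d1 hjj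
    rcases lt_trichotomy k k' with hkk | hkk | hkk
    · clear d2 d3 d4 d5 d6 d7 c1 hcol hcol'
      omega
    · clear d2 d3 d4 d5 d6 d7 c1 c2 c3 c4 c5 c6 c7
      omega
    · clear c1 c2 c3 c4 c5 c6 c7 hcol hcol'
      omega

end moves

/-! ### Neighbouring cells are joined by a move. -/

/-- For j ≤ m the letter m + 2 at position j commutes with the letter j that follows it. For j = m +
1, which forces k = m + 2, positions m + 1 to m + 3 read m+2, m+1, m+2 and are braided. -/
theorem exists_commutation_or_braid_succ_right {m k j : ℕ} (hj : j + 1 ≤ k) (hk : k ≤ m + 2) :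
    (∃ p, p + 1 < m + 5 ∧
      (wordLetter m k j p + 1 < wordLetter m k j (p + 1) ∨
        wordLetter m k j (p + 1) + 1 < wordLetter m k j p) ∧
      wordLetter m k (j + 1) p = wordLetter m k j (p + 1) ∧
      wordLetter m k (j + 1) (p + 1) = wordLetter m k j p ∧
      ∀ i < m + 5, i ≠ p → i ≠ p + 1 → wordLetter m k (j + 1) i = wordLetter m k j i) ∨
    (∃ p, p + 2 < m + 5 ∧
      (wordLetter m k j p + 1 = wordLetter m k j (p + 1) ∨
        wordLetter m k j (p + 1) + 1 = wordLetter m k j p) ∧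
      wordLetter m k j (p + 2) = wordLetter m k j p ∧
      wordLetter m k (j + 1) p = wordLetter m k j (p + 1) ∧
      wordLetter m k (j + 1) (p + 1) = wordLetter m k j p ∧
      wordLetter m k (j + 1) (p + 2) = wordLetter m k j (p + 1) ∧
      ∀ i < m + 5, i ≠ p → i ≠ p + 1 → i ≠ p + 2 →
        wordLetter m k (j + 1) i = wordLetter m k j i) := by
  rcases Nat.lt_or_ge m j with hm | hm
  · obtain rfl : j = m + 1 := by omega
    obtain rfl : k = m + 2 := by omega
    refine Or.inr ⟨m + 1, by omega, ?_, ?_, ?_, ?_, ?_, fun i hi h0 h1 h2 => ?_⟩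
    · simp [wordLetter]
    · simp [wordLetter]; omega
    · simp [wordLetter]
    · simp [wordLetter]
    · simp [wordLetter]
    · unfold wordLetter
      split_ifs <;> omega
  · have h1 : wordLetter m k j (j + 1) = j := wordLetter_of_mem (by omega) hj (by omega)
    refine Or.inl ⟨j, by omega, ?_, ?_, ?_, fun i hi h2 h3 => ?_⟩
    · rw [wordLetter_self, h1]; omega
    · rw [h1, wordLetter_of_lt (by omega)]
    · rw [wordLetter_self, wordLetter_self]
    · rcases lt_or_gt_of_ne h2 with h | h
      · rw [wordLetter_of_lt h, wordLetter_of_lt (by omega)]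
      · simp [wordLetter, show ¬ i < j by omega, show ¬ i < j + 1 by omega, h2, h3,
          show ¬ j = m + 1 by omega, show ¬ j = m + 2 by omega]

/-- For k < m the letter m + 1 commutes with the letter k after it; for k = m the factor m+1, m, m+1
is braided; for k = m + 1 the final letters m and m + 2 are exchanged. -/
theorem exists_commutation_or_braid_succ_left {m k j : ℕ} (hj : j ≤ k) (hk : k + 1 ≤ m + 2) :
    (∃ p, p + 1 < m + 5 ∧
      (wordLetter m k j p + 1 < wordLetter m k j (p + 1) ∨
        wordLetter m k j (p + 1) + 1 < wordLetter m k j p) ∧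
      wordLetter m (k + 1) j p = wordLetter m k j (p + 1) ∧
      wordLetter m (k + 1) j (p + 1) = wordLetter m k j p ∧
      ∀ i < m + 5, i ≠ p → i ≠ p + 1 → wordLetter m (k + 1) j i = wordLetter m k j i) ∨
    (∃ p, p + 2 < m + 5 ∧
      (wordLetter m k j p + 1 = wordLetter m k j (p + 1) ∨
        wordLetter m k j (p + 1) + 1 = wordLetter m k j p) ∧
      wordLetter m k j (p + 2) = wordLetter m k j p ∧
      wordLetter m (k + 1) j p = wordLetter m k j (p + 1) ∧
      wordLetter m (k + 1) j (p + 1) = wordLetter m k j p ∧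
      wordLetter m (k + 1) j (p + 2) = wordLetter m k j (p + 1) ∧
      ∀ i < m + 5, i ≠ p → i ≠ p + 1 → i ≠ p + 2 →
        wordLetter m (k + 1) j i = wordLetter m k j i) := by
  obtain hm | rfl | rfl : k < m ∨ k = m ∨ k = m + 1 := by omega
  · have h1 : wordLetter m k j (k + 1) = m + 1 := wordLetter_add_one hj (by omega)
    have h2 : wordLetter m k j (k + 2) = k := wordLetter_of_add_two_le hj (by omega) (by omega)
    have h3 : wordLetter m (k + 1) j (k + 1) = k :=
      wordLetter_of_mem (by omega) (by omega) (by omega)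
    have h4 : wordLetter m (k + 1) j (k + 2) = m + 1 :=
      wordLetter_add_one (by omega) (by omega)
    refine Or.inl ⟨k + 1, by omega, ?_, ?_, ?_, fun i hi h5 h6 => ?_⟩
    · rw [h1, h2]; omega
    · rw [h3, h2]
    · rw [h4, h1]
    · rcases Nat.lt_or_ge k i with h | h
      · rw [wordLetter_of_add_two_le hj (by omega) (by omega),
          wordLetter_of_add_two_le (by omega) (by omega) (by omega)]
      · simp [wordLetter, show i < m + 3 by omega, h, show i ≤ k + 1 by omega]
  · have f1 : wordLetter k k j (k + 1) = k + 1 := wordLetter_add_one hj (by omega)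
    have f2 : wordLetter k k j (k + 2) = k := wordLetter_of_add_two_le hj le_rfl (by omega)
    have f3 : wordLetter k k j (k + 3) = k + 1 := wordLetter_of_add_two_le hj le_rfl (by omega)
    have f4 : wordLetter k k j (k + 4) = k + 2 := wordLetter_of_add_two_le hj le_rfl (by omega)
    have g1 : wordLetter k (k + 1) j (k + 1) = k :=
      wordLetter_of_mem (by omega) (by omega) (by omega)
    have g2 : wordLetter k (k + 1) j (k + 2) = k + 1 := wordLetter_add_one (by omega) (by omega)
    obtain ⟨g3, g4⟩ := wordLetter_of_eq_add_one (m := k) (j := j) (by omega)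
    refine Or.inr ⟨k + 1, by omega, ?_, ?_, ?_, ?_, ?_, fun i hi h0 h1 h2 => ?_⟩
    · rw [f1, f2]; omega
    · rw [f3, f1]
    · rw [g1, f2]
    · rw [g2, f1]
    · rw [g3, f2]
    · rcases Nat.lt_or_ge k i with h | h
      · obtain rfl : i = k + 4 := by omega
        rw [g4, f4]
      · simp [wordLetter, show i < k + 3 by omega, h, show i ≤ k + 1 by omega]
  · obtain ⟨f3, f4⟩ := wordLetter_of_eq_add_one hj
    obtain ⟨g3, g4⟩ := wordLetter_of_eq_add_two (m := m) (j := j) (by omega)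
    rw [if_neg (by omega)] at g3
    refine Or.inl ⟨m + 3, by omega, ?_, ?_, ?_, fun i hi h5 h6 => ?_⟩
    · rw [f3, f4]; omega
    · rw [g3, f4]
    · rw [g4, f3]
    · unfold wordLetter
      split_ifs <;> omega

/-! ### The isomorphism with the staircase graph. -/

/-- The reduced word of `ₙw`, `n = m + 4`, with parameters `j ≤ k`. -/
def stairWord (m k j : ℕ) : List (Fin (m + 3)) :=
  ((List.range (m + 5)).map fun i => Fin.ofNat (m + 3) (wordLetter m k j i)).reverse

/-- `Fin.ofNat` reduces modulo m + 3, which changes nothing for letters of a staircase cell. -/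
theorem val_ofNat_wordLetter {m k j : ℕ} (hj : j ≤ k) (hk : k ≤ m + 2) {i : ℕ}
    (hi : i < m + 5) : (Fin.ofNat (m + 3) (wordLetter m k j i)).val = wordLetter m k j i :=
  Nat.mod_eq_of_lt (wordLetter_lt hk hj hi)

theorem map_val_reverse_stairWord {m k j : ℕ} (hj : j ≤ k) (hk : k ≤ m + 2) :
    (stairWord m k j).reverse.map Fin.val = (List.range (m + 5)).map (wordLetter m k j) := by
  rw [stairWord, List.reverse_reverse, List.map_map]
  exact List.map_congr_left fun i hi => val_ofNat_wordLetter hj hk (List.mem_range.mp hi)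

theorem isReducedWord_nw_iff (m : ℕ) (hn : 4 ≤ m + 4) (l : List (Fin (m + 3))) :
    IsReducedWord (nw (m + 4) hn) l ↔ ∃ k j, j ≤ k ∧ k ≤ m + 2 ∧ l = stairWord m k j := by
  have h := isReducedWord_nw_reverse_iff m hn l.reverse
  rw [List.reverse_reverse] at h
  rw [h]
  refine exists_congr fun k => exists_congr fun j => and_congr_right fun hj =>
    and_congr_right fun hk => ?_
  rw [← map_val_reverse_stairWord hj hk, List.map_inj_right fun _ _ h => Fin.ext h,
    List.reverse_inj]

theorem stairWord_injective {m k j k' j' : ℕ} (hj : j ≤ k) (hk : k ≤ m + 2) (hj' : j' ≤ k')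
    (hk' : k' ≤ m + 2) (h : stairWord m k j = stairWord m k' j') : k = k' ∧ j = j' := by
  have h1 : (List.range (m + 5)).map (wordLetter m k j) =
      (List.range (m + 5)).map (wordLetter m k' j') := by
    rw [← map_val_reverse_stairWord hj hk, ← map_val_reverse_stairWord hj' hk', h]
  have h2 : ∀ i < m + 5, wordLetter m k j i = wordLetter m k' j' i := fun i hi =>
    List.map_inj_left.mp h1 i (List.mem_range.mpr hi)
  by_contra hne
  -- With the empty predicate, each known difference becomes a contradiction.
  obtain ⟨a1, a2, a3, a4, a5, a6, a7⟩ := differences_mem (P := fun _ => False) hj hk hj' hk'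
    fun i hi hn => hn (h2 i hi)
  obtain ⟨b1, b2, b3, b4, b5, b6, b7⟩ := differences_mem (P := fun _ => False) hj' hk' hj hk
    fun i hi hn => hn (h2 i hi).symm
  grind

theorem commutationMove_stairWord_iff {m k j k' j' : ℕ} (hj : j ≤ k) (hk : k ≤ m + 2)
    (hj' : j' ≤ k') (hk' : k' ≤ m + 2) :
    CommutationMove (stairWord m k j) (stairWord m k' j') ↔
      ∃ p, p + 1 < m + 5 ∧
      (wordLetter m k j p + 1 < wordLetter m k j (p + 1) ∨
        wordLetter m k j (p + 1) + 1 < wordLetter m k j p) ∧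
      wordLetter m k' j' p = wordLetter m k j (p + 1) ∧
      wordLetter m k' j' (p + 1) = wordLetter m k j p ∧
      ∀ i < m + 5, i ≠ p → i ≠ p + 1 → wordLetter m k' j' i = wordLetter m k j i := by
  have hrev : CommutationMove (stairWord m k j) (stairWord m k' j') ↔
      CommutationMove (stairWord m k j).reverse (stairWord m k' j').reverse :=
    ⟨CommutationMove.reverse, fun h => by simpa using h.reverse⟩
  have hv {i : ℕ} (hi : i < m + 5) := val_ofNat_wordLetter hj hk hi
  have hv' {i : ℕ} (hi : i < m + 5) := val_ofNat_wordLetter hj' hk' hi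
  rw [hrev, stairWord, stairWord, List.reverse_reverse, List.reverse_reverse,
    commutationMove_map_range_iff]
  refine exists_congr fun p => and_congr_right fun hp => ?_
  have hp0 : p < m + 5 := by omega
  simp only [Fin.ext_iff, hv hp, hv hp0, hv' hp, hv' hp0]
  refine and_congr_right fun _ => and_congr_right fun _ => and_congr_right fun _ =>
    forall_congr' fun i => forall_congr' fun hi => ?_
  rw [hv hi, hv' hi]

theorem braidMove_stairWord_iff {m k j k' j' : ℕ} (hj : j ≤ k) (hk : k ≤ m + 2)
    (hj' : j' ≤ k') (hk' : k' ≤ m + 2) :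
    BraidMove (stairWord m k j) (stairWord m k' j') ↔
      ∃ p, p + 2 < m + 5 ∧
      (wordLetter m k j p + 1 = wordLetter m k j (p + 1) ∨
        wordLetter m k j (p + 1) + 1 = wordLetter m k j p) ∧
      wordLetter m k j (p + 2) = wordLetter m k j p ∧
      wordLetter m k' j' p = wordLetter m k j (p + 1) ∧
      wordLetter m k' j' (p + 1) = wordLetter m k j p ∧
      wordLetter m k' j' (p + 2) = wordLetter m k j (p + 1) ∧
      ∀ i < m + 5, i ≠ p → i ≠ p + 1 → i ≠ p + 2 →
        wordLetter m k' j' i = wordLetter m k j i := by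
  have hrev : BraidMove (stairWord m k j) (stairWord m k' j') ↔
      BraidMove (stairWord m k j).reverse (stairWord m k' j').reverse :=
    ⟨BraidMove.reverse, fun h => by simpa using h.reverse⟩
  have hv {i : ℕ} (hi : i < m + 5) := val_ofNat_wordLetter hj hk hi
  have hv' {i : ℕ} (hi : i < m + 5) := val_ofNat_wordLetter hj' hk' hi
  rw [hrev, stairWord, stairWord, List.reverse_reverse, List.reverse_reverse,
    braidMove_map_range_iff]
  refine exists_congr fun p => and_congr_right fun hp => ?_
  have hp0 : p < m + 5 := by omega
  have hp1 : p + 1 < m + 5 := by omega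
  simp only [Fin.ext_iff, hv hp, hv hp0, hv hp1, hv' hp, hv' hp0, hv' hp1]
  refine and_congr_right fun _ => and_congr_right fun _ => and_congr_right fun _ =>
    and_congr_right fun _ => and_congr_right fun _ =>
    forall_congr' fun i => forall_congr' fun hi => ?_
  rw [hv hi, hv' hi]

theorem stairWord_move_iff {m k j k' j' : ℕ} (hj : j ≤ k) (hk : k ≤ m + 2)
    (hj' : j' ≤ k') (hk' : k' ≤ m + 2) :
    (CommutationMove (stairWord m k j) (stairWord m k' j') ∨
      BraidMove (stairWord m k j) (stairWord m k' j')) ↔ CellAdj k j k' j' := by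
  have symm {a b : List (Fin (m + 3))} (h : CommutationMove a b ∨ BraidMove a b) :
      CommutationMove b a ∨ BraidMove b a := h.imp CommutationMove.symm BraidMove.symm
  constructor
  · intro h
    have hne : ¬ (k = k' ∧ j = j') := by
      rintro ⟨rfl, rfl⟩
      exact h.elim (not_commutationMove_self _) (not_braidMove_self _)
    rw [commutationMove_stairWord_iff hj hk hj' hk', braidMove_stairWord_iff hj hk hj' hk'] at h
    rcases h with ⟨p, -, -, -, -, h⟩ | ⟨p, hp, -, h1, h2, -, h3, h⟩
    · exact cellAdj_of_two_differences hj hk hj' hk' p hne h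
    · exact cellAdj_of_three_differences hj hk hj' hk' p hne hp h1.symm (h2.trans h3.symm) h
  · rintro (⟨rfl, rfl | rfl⟩ | ⟨rfl, rfl | rfl⟩)
    · rw [commutationMove_stairWord_iff hj hk hj' hk', braidMove_stairWord_iff hj hk hj' hk']
      exact exists_commutation_or_braid_succ_right hj' hk
    · apply symm
      rw [commutationMove_stairWord_iff hj' hk' hj hk, braidMove_stairWord_iff hj' hk' hj hk]
      exact exists_commutation_or_braid_succ_right hj hk
    · rw [commutationMove_stairWord_iff hj hk hj' hk', braidMove_stairWord_iff hj hk hj' hk']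
      exact exists_commutation_or_braid_succ_left hj hk'
    · apply symm
      rw [commutationMove_stairWord_iff hj' hk' hj hk, braidMove_stairWord_iff hj' hk' hj hk]
      exact exists_commutation_or_braid_succ_left hj' hk

/-- The staircase grid graph with rows `0, …, M - 1`, row `k` having the cells `0, …, k`. -/
def stairGraph (M : ℕ) : SimpleGraph (Σ k : Fin M, Fin (k.val + 1)) where
  Adj p q := CellAdj p.1.val p.2.val q.1.val q.2.val
  symm := ⟨fun _ _ h => by unfold CellAdj at *; omega⟩
  loopless := ⟨fun _ h => by unfold CellAdj at h; omega⟩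

theorem stair_ext {M : ℕ} {p q : Σ k : Fin M, Fin (k.val + 1)} (h1 : p.1.val = q.1.val)
    (h2 : p.2.val = q.2.val) : p = q := by
  obtain ⟨⟨k, hk⟩, ⟨j, hj⟩⟩ := p
  obtain ⟨⟨k', hk'⟩, ⟨j', hj'⟩⟩ := q
  simp only at h1 h2
  subst h1 h2
  rfl

/-- The graph of reduced words of `ₙw` is a staircase grid. -/
noncomputable def stairIso (m : ℕ) (hn : 4 ≤ m + 4) :
    stairGraph (m + 3) ≃g reducedWordGraph (nw (m + 4) hn) where
  toEquiv := Equiv.ofBijective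
    (fun p => ⟨stairWord m p.1.val p.2.val, (isReducedWord_nw_iff m hn _).mpr
      ⟨p.1.val, p.2.val, by omega, by omega, rfl⟩⟩) (by
    constructor
    · intro p q h
      obtain ⟨h1, h2⟩ := stairWord_injective (by omega) (by omega) (by omega) (by omega)
        (congrArg Subtype.val h)
      exact stair_ext h1 h2
    · rintro ⟨l, hl⟩
      obtain ⟨k, j, hj, hk, rfl⟩ := (isReducedWord_nw_iff m hn l).mp hl
      exact ⟨⟨⟨k, by omega⟩, ⟨j, by simp only; omega⟩⟩, rfl⟩)
  map_rel_iff' := by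
    intro p q
    exact stairWord_move_iff (by omega) (by omega) (by omega) (by omega)

/-! ### Degrees in the staircase. -/

open Finset in
theorem degree_stairGraph {M : ℕ} (p : Σ k : Fin M, Fin (k.val + 1))
    [Fintype ((stairGraph M).neighborSet p)] :
    (stairGraph M).degree p = (if p.1.val + 1 < M then 1 else 0) + (if 0 < p.2.val then 1 else 0)
      + (if p.2.val < p.1.val then 2 else 0) := by
  classical
  obtain ⟨⟨k, hk⟩, ⟨j, hj⟩⟩ := p
  simp only at hj
  let A : Finset (ℕ × ℕ) := if k + 1 < M then {(k + 1, j)} else ∅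
  let B : Finset (ℕ × ℕ) := if 0 < j then {(k, j - 1)} else ∅
  -- The cells (k, j + 1) and (k - 1, j) exist under the same condition, j < k; this is the 2 in the
  -- formula.
  let C : Finset (ℕ × ℕ) := if j < k then {(k, j + 1), (k - 1, j)} else ∅
  have himg : ((stairGraph M).neighborFinset ⟨⟨k, hk⟩, ⟨j, hj⟩⟩).image
      (fun q => (q.1.val, q.2.val)) = A ∪ B ∪ C := by
    ext ⟨a, b⟩
    simp only [mem_image, SimpleGraph.mem_neighborFinset, mem_union]
    have hmem : ((a, b) ∈ A ∨ (a, b) ∈ B) ∨ (a, b) ∈ C ↔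
        (k + 1 < M ∧ a = k + 1 ∧ b = j) ∨ (0 < j ∧ a = k ∧ b = j - 1) ∨
        (j < k ∧ (a = k ∧ b = j + 1 ∨ a = k - 1 ∧ b = j)) := by
      simp only [A, B, C]
      split_ifs <;> simp [*]
      all_goals tauto
    rw [hmem]
    constructor
    · rintro ⟨⟨⟨k', hk'⟩, ⟨j', hj'⟩⟩, h, h'⟩
      simp only [Prod.mk.injEq] at h'
      simp only at hj'
      obtain ⟨rfl, rfl⟩ := h'
      have h : CellAdj k j k' j' := h
      unfold CellAdj at h
      omega
    · intro h
      refine ⟨⟨⟨a, by omega⟩, ⟨b, by simp only; omega⟩⟩, ?_, rfl⟩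
      show CellAdj k j a b
      unfold CellAdj
      omega
  have hcard : #((stairGraph M).neighborFinset ⟨⟨k, hk⟩, ⟨j, hj⟩⟩) = #(A ∪ B ∪ C) := by
    rw [← himg, card_image_of_injective]
    intro q r h
    simp only [Prod.mk.injEq] at h
    exact stair_ext h.1 h.2
  rw [← SimpleGraph.card_neighborFinset_eq_degree, hcard, card_union_of_disjoint,
    card_union_of_disjoint]
  · congr 1
    · congr 1
      · simp only [A]; split_ifs <;> rfl
      · simp only [B]; split_ifs <;> rfl
    · simp only [C]
      split_ifs
      · rw [card_pair]; simp
      · rfl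
  · simp only [A, B]
    split_ifs <;> simp
  · simp only [A, B, C]
    split_ifs <;> simp <;> omega

open Polynomial in
theorem vertexDegreePolynomial_stairGraph (m : ℕ) [DecidableRel (stairGraph (m + 3)).Adj] :
    vertexDegreePolynomial (stairGraph (m + 3)) =
      2 * X + C ((m : ℤ) + 2) * X ^ 2 + C (2 * (m : ℤ) + 2) * X ^ 3
        + C ((m + 1).choose 2 : ℤ) * X ^ 4 := by
  -- Row k + 1, if not the last: degree 3 at j = 0, degree 2 on the diagonal, degree 4 at the k
  -- cells between.
  have hrow (k : ℕ) : ∑ j ∈ Finset.range (k + 2), (X : ℤ[X]) ^ (1 +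
      (if 0 < j then 1 else 0) + (if j < k + 1 then 2 else 0)) =
        X ^ 3 + C (k : ℤ) * X ^ 4 + X ^ 2 := by
    rw [Finset.sum_range_succ, Finset.sum_range_succ']
    have : ∑ j ∈ Finset.range k, (X : ℤ[X]) ^ (1 +
      (if 0 < j + 1 then 1 else 0) + (if j + 1 < k + 1 then 2 else 0)) =
        ∑ j ∈ Finset.range k, X ^ 4 := Finset.sum_congr rfl fun j hj => by
      rw [Finset.mem_range] at hj
      simp [hj]
    rw [this]
    simp
    ring
  -- In the last row every cell loses its neighbour in the next row, so each exponent drops by one.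
  have hlast (k : ℕ) : ∑ j ∈ Finset.range (k + 2), (X : ℤ[X]) ^ (0 +
      (if 0 < j then 1 else 0) + (if j < k + 1 then 2 else 0)) =
        X ^ 2 + C (k : ℤ) * X ^ 3 + X := by
    rw [Finset.sum_range_succ, Finset.sum_range_succ']
    have : ∑ j ∈ Finset.range k, (X : ℤ[X]) ^ (0 +
      (if 0 < j + 1 then 1 else 0) + (if j + 1 < k + 1 then 2 else 0)) =
        ∑ j ∈ Finset.range k, X ^ 3 := Finset.sum_congr rfl fun j hj => by
      rw [Finset.mem_range] at hj
      simp [hj]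
    rw [this]
    simp
    ring
  have hmid (m : ℕ) : ∑ k ∈ Finset.range m, ((X : ℤ[X]) ^ 3 + C (k : ℤ) * X ^ 4 + X ^ 2) =
      C (m : ℤ) * X ^ 3 + C (m.choose 2 : ℤ) * X ^ 4 + C (m : ℤ) * X ^ 2 := by
    induction m with
    | zero => simp
    | succ m ih =>
      rw [Finset.sum_range_succ, ih, Nat.choose_succ_succ' m 1]
      simp
      ring
  have hsum : vertexDegreePolynomial (stairGraph (m + 3)) =
      ∑ k ∈ Finset.range (m + 3), ∑ j ∈ Finset.range (k + 1), (X : ℤ[X]) ^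
        ((if k + 1 < m + 3 then 1 else 0) + (if 0 < j then 1 else 0)
          + (if j < k then 2 else 0)) := by
    unfold vertexDegreePolynomial
    simp only [degree_stairGraph]
    rw [Fintype.sum_sigma, ← Fin.sum_univ_eq_sum_range]
    refine Finset.sum_congr rfl fun k _ => ?_
    rw [← Fin.sum_univ_eq_sum_range]
  -- The last row and the single cell of row 0 are split off; each contributes one vertex of degree
  -- 1.
  rw [hsum, Finset.sum_range_succ, Finset.sum_range_succ']
  have hinner : ∑ k ∈ Finset.range (m + 1), ∑ j ∈ Finset.range (k + 1 + 1), (X : ℤ[X]) ^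
        ((if k + 1 + 1 < m + 3 then 1 else 0) + (if 0 < j then 1 else 0)
          + (if j < k + 1 then 2 else 0)) =
      ∑ k ∈ Finset.range (m + 1), (X ^ 3 + C (k : ℤ) * X ^ 4 + X ^ 2) :=
    Finset.sum_congr rfl fun k hk => by
      rw [Finset.mem_range] at hk
      rw [if_pos (by omega), hrow]
  rw [hinner, hmid, if_neg (show ¬ m + 2 + 1 < m + 3 by omega), hlast (m + 1)]
  simp
  ring

/-- The sum of the degrees is the derivative of the vertex-degree polynomial at `1`. -/
theorem sum_degree_eq_derivative_eval {V : Type*} [Fintype V] (G : SimpleGraph V)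
    [DecidableRel G.Adj] :
    ((∑ v, G.degree v : ℕ) : ℤ) = (vertexDegreePolynomial G).derivative.eval 1 := by
  simp [vertexDegreePolynomial, Polynomial.eval_finsetSum, Polynomial.derivative_X_pow]

theorem vertexDegreePolynomial_congr {V W : Type*} [Fintype V] [Fintype W] {G : SimpleGraph V}
    {H : SimpleGraph W} [DecidableRel G.Adj] [DecidableRel H.Adj] (e : G ≃g H) :
    vertexDegreePolynomial G = vertexDegreePolynomial H := by
  unfold vertexDegreePolynomial
  refine Fintype.sum_equiv e.toEquiv _ _ fun v => ?_
  rw [← e.degree_eq v]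
  rfl

/-! ### Four-cycles and unit squares. -/

theorem copyCount_congr {V V' W : Type*} [Fintype V] [Fintype V'] {G : SimpleGraph V}
    {G' : SimpleGraph V'} (e : G ≃g G') (H : SimpleGraph W) : G.copyCount H = G'.copyCount H := by
  classical
  unfold SimpleGraph.copyCount
  refine Finset.card_nbij' (fun S => S.map e.toCopy.toHom) (fun S => S.map e.symm.toCopy.toHom)
    ?_ ?_ ?_ ?_
  · intro S hS
    simp only [Finset.coe_filter, Finset.mem_univ, true_and, Set.mem_ofPred_eq] at hS ⊢
    exact hS.map fun f => (e.toCopy.isoSubgraphMap S).comp f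
  · intro S hS
    simp only [Finset.coe_filter, Finset.mem_univ, true_and, Set.mem_ofPred_eq] at hS ⊢
    exact hS.map fun f => (e.symm.toCopy.isoSubgraphMap S).comp f
  · intro S _
    have : e.symm.toCopy.toHom.comp e.toCopy.toHom = SimpleGraph.Hom.id := by
      ext x; exact e.symm_apply_apply x
    simp only [← SimpleGraph.Subgraph.map_comp, this, SimpleGraph.Subgraph.map_id]
  · intro S _
    have : e.toCopy.toHom.comp e.symm.toCopy.toHom = SimpleGraph.Hom.id := by
      ext x; exact e.apply_symm_apply x
    simp only [← SimpleGraph.Subgraph.map_comp, this, SimpleGraph.Subgraph.map_id]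

/-- The unit square of cells with lowest corner `(k, j)`. -/
def unitSquare (M k j : ℕ) : Set (Σ k : Fin M, Fin (k.val + 1)) :=
  {p | (p.1.val = k ∨ p.1.val = k + 1) ∧ (p.2.val = j ∨ p.2.val = j + 1)}

/-- Opposite vertices have two distinct common neighbours. Two cells in line at distance two share
only the middle one, so opposite vertices must be diagonal in a unit square. -/
theorem four_cycle_cells {a0 b0 a1 b1 a2 b2 a3 b3 : ℕ} (h01 : CellAdj a0 b0 a1 b1)
    (h12 : CellAdj a1 b1 a2 b2) (h23 : CellAdj a2 b2 a3 b3) (h30 : CellAdj a3 b3 a0 b0)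
    (h02 : ¬ (a0 = a2 ∧ b0 = b2)) (h13 : ¬ (a1 = a3 ∧ b1 = b3)) :
    ((a1 = a0 ∧ b1 = b2 ∧ a3 = a2 ∧ b3 = b0) ∨ (a1 = a2 ∧ b1 = b0 ∧ a3 = a0 ∧ b3 = b2)) ∧
      (a2 = a0 + 1 ∨ a0 = a2 + 1) ∧ (b2 = b0 + 1 ∨ b0 = b2 + 1) := by
  unfold CellAdj at *
  rcases h01 with ⟨h, h' | h'⟩ | ⟨h, h' | h'⟩ <;> rcases h12 with ⟨g, g' | g'⟩ | ⟨g, g' | g'⟩ <;>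
    omega

theorem four_cycle_mem_iff {a0 b0 a1 b1 a2 b2 a3 b3 : ℕ}
    (h : ((a1 = a0 ∧ b1 = b2 ∧ a3 = a2 ∧ b3 = b0) ∨ (a1 = a2 ∧ b1 = b0 ∧ a3 = a0 ∧ b3 = b2)) ∧
      (a2 = a0 + 1 ∨ a0 = a2 + 1) ∧ (b2 = b0 + 1 ∨ b0 = b2 + 1)) :
    ∃ k j, ∀ a b, ((a = k ∨ a = k + 1) ∧ (b = j ∨ b = j + 1)) ↔
      (a = a0 ∧ b = b0) ∨ (a = a1 ∧ b = b1) ∨ (a = a2 ∧ b = b2) ∨ (a = a3 ∧ b = b3) := by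
  -- Opposite vertices differ by one in each coordinate, so the minima give the lowest corner.
  refine ⟨min a0 a2, min b0 b2, fun a b => ?_⟩
  obtain ⟨⟨rfl, rfl, rfl, rfl⟩ | ⟨rfl, rfl, rfl, rfl⟩, rfl | rfl, rfl | rfl⟩ := h <;>
    simp only [Nat.le_add_right, min_eq_left, min_eq_right] <;> omega

/-- The chessboard colouring: the staircase is bipartite. As C₄ is complete bipartite, a four-cycle
has no chord and is determined by its vertex set. -/
theorem parity_of_cellAdj {k j k' j' : ℕ} (h : CellAdj k j k' j') :
    (k + j) % 2 ≠ (k' + j') % 2 := by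
  unfold CellAdj at h
  omega

theorem cycleGraph_four_adj_iff (x y : Fin 4) :
    (SimpleGraph.cycleGraph 4).Adj x y ↔ x.val % 2 ≠ y.val % 2 := by
  rw [SimpleGraph.cycleGraph_adj]
  revert x y
  decide

theorem copy_cycleGraph_four_facts {M : ℕ}
    (f : SimpleGraph.Copy (SimpleGraph.cycleGraph 4) (stairGraph M)) (x y : Fin 4)
    (h : x.val % 2 ≠ y.val % 2) :
    CellAdj (f x).1.val (f x).2.val (f y).1.val (f y).2.val :=
  f.toHom.map_adj ((cycleGraph_four_adj_iff x y).mpr h)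

/-- The four-cycles of the staircase are induced. -/
theorem toSubgraph_copy_cycleGraph_four {M : ℕ}
    (f : SimpleGraph.Copy (SimpleGraph.cycleGraph 4) (stairGraph M)) :
    f.toSubgraph = (⊤ : (stairGraph M).Subgraph).induce (Set.range f) := by
  -- Up to the colour of `f 0`, the colour of a vertex of the copy is the parity of its index.
  have hpar (x : Fin 4) : ((f x).1.val + (f x).2.val) % 2 =
      ((f 0).1.val + (f 0).2.val + x.val) % 2 := by
    have h1 := parity_of_cellAdj (copy_cycleGraph_four_facts f 0 1 (by decide))
    have h2 := parity_of_cellAdj (copy_cycleGraph_four_facts f 1 2 (by decide))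
    have h3 := parity_of_cellAdj (copy_cycleGraph_four_facts f 0 3 (by decide))
    fin_cases x <;> simp <;> omega
  ext p q
  · simp
  · simp only [SimpleGraph.Subgraph.map_adj, Relation.Map, SimpleGraph.Subgraph.top_adj,
      SimpleGraph.Subgraph.induce_adj, Set.mem_range]
    constructor
    · rintro ⟨x, y, hxy, rfl, rfl⟩
      exact ⟨⟨x, rfl⟩, ⟨y, rfl⟩, f.toHom.map_adj hxy⟩
    · rintro ⟨⟨x, rfl⟩, ⟨y, rfl⟩, hxy⟩
      refine ⟨x, y, ?_, rfl, rfl⟩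
      rw [cycleGraph_four_adj_iff]
      have := parity_of_cellAdj hxy
      rw [hpar x, hpar y] at this
      omega

theorem range_copy_cycleGraph_four {M : ℕ}
    (f : SimpleGraph.Copy (SimpleGraph.cycleGraph 4) (stairGraph M)) :
    ∃ k j, j < k ∧ k + 1 < M ∧ Set.range f = unitSquare M k j := by
  have hne (x y : Fin 4) (h : x ≠ y) :
      ¬ ((f x).1.val = (f y).1.val ∧ (f x).2.val = (f y).2.val) := fun h' =>
    h (f.injective (stair_ext h'.1 h'.2))
  obtain ⟨k, j, hkj⟩ := four_cycle_mem_iff (four_cycle_cells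
    (copy_cycleGraph_four_facts f 0 1 (by decide)) (copy_cycleGraph_four_facts f 1 2 (by decide))
    (copy_cycleGraph_four_facts f 2 3 (by decide)) (copy_cycleGraph_four_facts f 3 0 (by decide))
    (hne 0 2 (by decide)) (hne 1 3 (by decide)))
  have hmem (a b : ℕ) (h : (a = k ∨ a = k + 1) ∧ (b = j ∨ b = j + 1)) :
      ∃ x, (f x).1.val = a ∧ (f x).2.val = b := by
    rcases (hkj a b).mp h with h | h | h | h
    · exact ⟨0, h.1.symm, h.2.symm⟩
    · exact ⟨1, h.1.symm, h.2.symm⟩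
    · exact ⟨2, h.1.symm, h.2.symm⟩
    · exact ⟨3, h.1.symm, h.2.symm⟩
  refine ⟨k, j, ?_, ?_, ?_⟩
  · obtain ⟨x, h1, h2⟩ := hmem k (j + 1) (by simp)
    have := (f x).2.isLt
    omega
  · obtain ⟨x, h1, h2⟩ := hmem (k + 1) j (by simp)
    have := (f x).1.isLt
    omega
  · ext p
    constructor
    · rintro ⟨x, rfl⟩
      refine (hkj _ _).mpr ?_
      fin_cases x <;> simp
    · intro hp
      obtain ⟨x, h1, h2⟩ := hmem _ _ hp
      exact ⟨x, stair_ext h1 h2⟩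

theorem exists_copy_range_eq_unitSquare {M k j : ℕ} (hj : j < k) (hk : k + 1 < M) :
    ∃ f : SimpleGraph.Copy (SimpleGraph.cycleGraph 4) (stairGraph M),
      Set.range f = unitSquare M k j := by
  let g (x : Fin 4) : Σ k : Fin M, Fin (k.val + 1) :=
    ⟨⟨k + (if x = 1 ∨ x = 2 then 1 else 0), by split_ifs <;> omega⟩,
      ⟨j + (if x = 2 ∨ x = 3 then 1 else 0), by simp only; split_ifs <;> omega⟩⟩
  have hg1 (x : Fin 4) : (g x).1.val = k + (if x = 1 ∨ x = 2 then 1 else 0) := rfl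
  have hg2 (x : Fin 4) : (g x).2.val = j + (if x = 2 ∨ x = 3 then 1 else 0) := rfl
  have hadj : ∀ x y : Fin 4, (SimpleGraph.cycleGraph 4).Adj x y →
      (stairGraph M).Adj (g x) (g y) := by
    intro x y h
    rw [cycleGraph_four_adj_iff] at h
    show CellAdj (k + (if x = 1 ∨ x = 2 then 1 else 0)) (j + (if x = 2 ∨ x = 3 then 1 else 0))
      (k + (if y = 1 ∨ y = 2 then 1 else 0)) (j + (if y = 2 ∨ y = 3 then 1 else 0))
    unfold CellAdj
    fin_cases x <;> fin_cases y <;> simp at h ⊢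
  have hinj : Function.Injective g := by
    intro x y h
    have h1 : (g x).1.val = (g y).1.val := by rw [h]
    have h2 : (g x).2.val = (g y).2.val := by rw [h]
    rw [hg1, hg1] at h1
    rw [hg2, hg2] at h2
    fin_cases x <;> fin_cases y <;> simp at h1 h2 ⊢
  refine ⟨⟨⟨g, fun {x y} h => hadj x y h⟩, hinj⟩, ?_⟩
  ext p
  constructor
  · rintro ⟨x, rfl⟩
    refine ⟨?_, ?_⟩
    · show (g x).1.val = k ∨ (g x).1.val = k + 1
      rw [hg1]
      split_ifs <;> simp
    · show (g x).2.val = j ∨ (g x).2.val = j + 1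
      rw [hg2]
      split_ifs <;> simp
  · rintro ⟨h1 | h1, h2 | h2⟩
    · exact ⟨0, stair_ext (by rw [h1]; rfl) (by rw [h2]; rfl)⟩
    · exact ⟨3, stair_ext (by rw [h1]; rfl) (by rw [h2]; rfl)⟩
    · exact ⟨1, stair_ext (by rw [h1]; rfl) (by rw [h2]; rfl)⟩
    · exact ⟨2, stair_ext (by rw [h1]; rfl) (by rw [h2]; rfl)⟩

theorem unitSquare_subset {M k j k' j' : ℕ} (hj : j < k) (hk : k + 1 < M)
    (h : unitSquare M k j ⊆ unitSquare M k' j') : k = k' ∧ j = j' := by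
  -- Two opposite corners already determine the square.
  have h1 : _ ∈ unitSquare M k' j' := h (show (⟨⟨k, by omega⟩, ⟨j, by simp only; omega⟩⟩ :
    Σ k : Fin M, Fin (k.val + 1)) ∈ unitSquare M k j from ⟨Or.inl rfl, Or.inl rfl⟩)
  have h2 : _ ∈ unitSquare M k' j' := h (show (⟨⟨k + 1, by omega⟩, ⟨j + 1, by simp only; omega⟩⟩ :
    Σ k : Fin M, Fin (k.val + 1)) ∈ unitSquare M k j from ⟨Or.inr rfl, Or.inr rfl⟩)
  simp only [unitSquare, Set.mem_ofPred_eq] at h1 h2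
  omega

/-- The staircase has one four-cycle for each of its unit squares. -/
theorem copyCount_stairGraph_cycleGraph_four (M : ℕ) :
    (stairGraph M).copyCount (SimpleGraph.cycleGraph 4) = (M - 1).choose 2 := by
  classical
  rw [SimpleGraph.copyCount_eq_card_image_copyToSubgraph]
  -- Lowest corners satisfy j < k, so that (k, j + 1) exists, and k < M - 1, so that row k + 1
  -- exists.
  let sq (s : Σ k : Fin (M - 1), Fin k.val) : (stairGraph M).Subgraph :=
    (⊤ : (stairGraph M).Subgraph).induce (unitSquare M s.1.val s.2.val)
  have himg : Finset.univ.image (SimpleGraph.Copy.toSubgraph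
      (A := SimpleGraph.cycleGraph 4) (B := stairGraph M)) = Finset.univ.image sq := by
    ext S
    simp only [Finset.mem_image, Finset.mem_univ, true_and]
    constructor
    · rintro ⟨f, rfl⟩
      obtain ⟨k, j, hj, hk, h⟩ := range_copy_cycleGraph_four f
      refine ⟨⟨⟨k, by omega⟩, ⟨j, hj⟩⟩, ?_⟩
      rw [toSubgraph_copy_cycleGraph_four, h]
    · rintro ⟨⟨k, j⟩, rfl⟩
      obtain ⟨f, hf⟩ := exists_copy_range_eq_unitSquare (M := M) j.isLt (by omega)
      refine ⟨f, ?_⟩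
      rw [toSubgraph_copy_cycleGraph_four, hf]
  have hinj : Function.Injective sq := by
    rintro ⟨⟨k, hk⟩, ⟨j, hj⟩⟩ ⟨⟨k', hk'⟩, ⟨j', hj'⟩⟩ h
    have hs : unitSquare M k j = unitSquare M k' j' := congrArg SimpleGraph.Subgraph.verts h
    simp only at hj hj'
    obtain ⟨rfl, rfl⟩ := unitSquare_subset hj (by omega) hs.subset
    rfl
  rw [himg, Finset.card_image_of_injective _ hinj, Finset.card_univ, Fintype.card_sigma]
  simp only [Fintype.card_fin]
  rw [Fin.sum_univ_eq_sum_range fun k => k, Finset.sum_range_id, Nat.choose_two_right]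

end ReducedWordGraph

/-! ### Transfer to the graph of reduced words. -/

theorem mainTheorem2 (n : ℕ) (hn : 4 ≤ n) :
    vertexDegreePolynomial (reducedWordGraph (nw n hn)) =
        2 * Polynomial.X
          + Polynomial.C ((n : ℤ) - 2) * Polynomial.X ^ 2
          + Polynomial.C (2 * (n : ℤ) - 6) * Polynomial.X ^ 3
          + Polynomial.C ((n - 3).choose 2 : ℤ) * Polynomial.X ^ 4 ∧
      ∑ v, (reducedWordGraph (nw n hn)).degree v = 4 * (n - 1).choose 2 ∧
      (reducedWordGraph (nw n hn)).copyCount (SimpleGraph.cycleGraph 4) = (n - 2).choose 2 := by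
  obtain ⟨m, rfl⟩ : ∃ m, n = m + 4 := ⟨n - 4, by omega⟩
  classical
  have hP := vertexDegreePolynomial_congr (stairIso m hn)
  rw [vertexDegreePolynomial_stairGraph] at hP
  refine ⟨?_, ?_, ?_⟩
  · rw [← hP, show m + 4 - 3 = m + 1 by omega]
    congr 4
    · push_cast; ring_nf
    · push_cast; ring_nf
  · have h := sum_degree_eq_derivative_eval (reducedWordGraph (nw (m + 4) hn))
    rw [← hP] at h
    -- The derivative at 1 is 4 · C(m + 1, 2) + 8m + 12, four times the left-hand side.
    have h1 : (m + 1).choose 2 + (m + 1) + (m + 2) = (m + 3).choose 2 := by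
      rw [Nat.choose_succ_succ' (m + 2) 1, Nat.choose_succ_succ' (m + 1) 1, Nat.choose_one_right,
        Nat.choose_one_right]
      simp only [Nat.reduceAdd]
      omega
    rw [show m + 4 - 1 = m + 3 by omega, ← h1]
    simp at h
    zify
    rw [h]
    ring
  · rw [← copyCount_congr (stairIso m hn), copyCount_stairGraph_cycleGraph_four]
    rfl
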